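/- Let $\mathbb T^2=\mathbb R^2/2\pi\mathbb Z^2$ with normalized Lebesgue measure $\mathrm m$, and let $A_0,A_1\in SL(2,\mathbb Z)$ be hyperbolic (no eigenvalue of modulus $1$), with unstable and stable eigendirections $E_u^{A_i},E_s^{A_i}$. A cone is a subset of $\mathbb R^2$ that is invariant under multiplication by real scalars and is spanned by two distinct lines through the origin (a double sector; each boundary line, apart from $0$, may or may not be included). Suppose $(A_0,A_1)$ has the cone property: there are cones $\mathcal E,\mathcal C$ with $\mathcal E\cap\mathcal C=\{0\}$ and numbers $0<\lambda_{\mathcal C}<1<\lambda_{\mathcal E}$ such that, for $i=0,1$, $A_i\mathcal E\subset\mathcal E$, $|A_ix|\ge\lambda_{\mathcal E}|x|$ for $x\in\mathcal E$, $E_u^{A_i}\cap\partial\mathcal E=\{0\}$, and $A_i^{-1}\mathcal C\subset\mathcal C$, $|A_i^{-1}x|\ge\lambda_{\mathcal C}^{-1}|x|$ for $x\in\mathcal C$, $E_s^{A_i}\cap\partial\mathcal C=\{0\}$. Let $\Omega=\{0,1\}^{\mathbb N}$ with the shift $\tau$ and the Bernoulli product measure $\mathbb P$ giving each $\omega(n)$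 the value $0$ with probability $p\in(0,1)$ and $1$ with probability $1-p$; put $A_\omega^n=A_{\omega(n-1)}\cdots A_{\omega(0)}$ and $\Phi(\omega,x)=(\tau\omega,A_{\omega(0)}x)$. An observable $f:\Omega\times\mathbb T^2\to\mathbb C$, with every $f(\omega,\cdot)$ integrable, is strongly Hölder with exponent $\beta$ if $\|f\|_\beta=\sup_{\omega}\sum_{q\in\mathbb Z^2}|\hat f(\omega,q)|\,|q|^\beta<\infty$, where $\hat f(\omega,q)=\int e^{-iq\cdot x}f(\omega,x)\,d\mathrm m(x)$. Define $$C_{f,g}(\omega,n)=\int f(\omega,A_\omega^nx)\,g(\omega,x)\,d\mathrm m(x)-\mathrm m(f(\omega,\cdot))\,\mathrm m(g(\omega,\cdot)),$$ $$C^\Phi_{f,g}(\omega,n)=\int (f\circ\Phi^n\cdot g)(\omega,x)\,d\mathrm m(x)-\mathrm m(f(\tau^n\omega,\cdot))\,\mathrm m(g(\omega,\cdot)).$$ Then $\rho:=\ln\min(\lambda_{\mathcal C}^{-1},\lambda_{\mathcal E})>0$ and there is $c>0$ such that, for all $\beta\in(0,1]$, all strongly Hölder $f,g$ with exponent $\beta$,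 all $\omega\in\Omega$ and all $n\in\mathbb N$, $$|C_{f,g}(\omega,n)|\le c\,\|f\|_\beta\|g\|_\beta\,e^{-\rho\beta n}\quad\text{and}\quad |C^\Phi_{f,g}(\omega,n)|\le c\,\|f\|_\beta\|g\|_\beta\,e^{-\rho\beta n}.$$ Moreover, the largest Lyapunov exponent (the largest of the limits $\lim_n\frac1n\ln|A_\omega^nx|$, $x\ne0$) equals, for almost every $\omega$, a constant $\chi^{(2)}\ge\ln\max(\lambda_{\mathcal C}^{-1},\lambda_{\mathcal E})$; and for every $\varepsilon>0$ there is a measurable function $C(\varepsilon)=C(\varepsilon,\omega)>0$ on $\Omega$ such that, for almost every $\omega$, for all $\beta\in(0,1]$, all strongly Hölder $f,g$ with exponent $\beta$ and all $n\in\mathbb N$, both $|C_{f,g}(\omega,n)|$ and $|C^\Phi_{f,g}(\omega,n)|$ are at most $$c\,\|f\|_\beta\|g\|_\beta\,C(\varepsilon,\omega)^{-\beta}\,e^{-(\chi^{(2)}-\varepsilon)\beta n}.$$ -/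

import Mathlib

open MeasureTheory Filter Topology
open scoped ENNReal

noncomputable section

namespace RandomToral

/-! ### The torus, hyperbolic toral automorphisms, and the linear action on the plane -/

/-- The circumference of the circle `ℝ / 2πℤ` is positive. -/
instance factTwoPiPos : Fact (0 < 2 * Real.pi) := ⟨Real.two_pi_pos⟩

/-- Integer `2 × 2` matrices. -/
abbrev IntMat := Matrix (Fin 2) (Fin 2) ℤ

/-- The Euclidean plane. -/
abbrev Plane := EuclideanSpace ℝ (Fin 2)

/-- The torus `𝕋² = ℝ² / 2πℤ²`. -/
abbrev Torus := Fin 2 → AddCircle (2 * Real.pi)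

/-- The normalized Lebesgue measure `dm = dx / (2π)²` on the torus. -/
def torusMeasure : Measure Torus :=
  Measure.pi (fun _ => (AddCircle.haarAddCircle : Measure (AddCircle (2 * Real.pi))))

/-- The action `x ↦ M x (mod 2π)` of an integer matrix on the torus. -/
def torusMap (M : IntMat) (x : Torus) : Torus := fun i => ∑ j, M i j • x j

/-- The linear action of an integer matrix on the Euclidean plane. -/
def planeMap (M : IntMat) : Plane →ₗ[ℝ] Plane :=
  Matrix.toEuclideanLin (M.map (fun z : ℤ => (z : ℝ)))

/-- `M` defines a hyperbolic toral automorphism of determinant `+1`: no (complex) eigenvalue of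
`M` has modulus one. -/
def IsHyperbolic (M : IntMat) : Prop :=
  M.det = 1 ∧
    ∀ μ : ℂ, Module.End.HasEigenvalue (Matrix.toLin' (M.map (fun z : ℤ => (z : ℂ)))) μ → ‖μ‖ ≠ 1

/-- The unstable eigendirection of `M`: the eigenvectors (and `0`) for an eigenvalue of modulus
larger than one. -/
def unstableDir (M : IntMat) : Set Plane := {x | ∃ μ : ℝ, 1 < |μ| ∧ planeMap M x = μ • x}

/-- The stable eigendirection of `M`: the eigenvectors (and `0`) for an eigenvalue of modulus
smaller than one. -/
def stableDir (M : IntMat) : Set Plane := {x | ∃ μ : ℝ, |μ| < 1 ∧ planeMap M x = μ • x}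

/-! ### Cones -/

/-- A cone: a set of the plane, invariant under multiplication by scalars, that is spanned by two
distinct lines `ℝu` and `ℝv` through the origin, i.e. one of the two closed double sectors bounded
by these lines. Either boundary line may be left out, apart from the origin (as happens when a
closed cone is replaced by its complement together with the origin). -/
def IsCone (S : Set Plane) : Prop :=
  (∀ (t : ℝ), ∀ x ∈ S, t • x ∈ S) ∧
  ∃ u v : Plane, LinearIndependent ℝ ![u, v] ∧
    {x : Plane | ∃ a b : ℝ, 0 < a * b ∧ x = a • u + b • v} ⊆ S ∧
    S ⊆ {x : Plane | ∃ a b : ℝ, 0 ≤ a * b ∧ x = a • u + b • v}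

/-- `E` is an expansion cone with rate `lamE` for the pair `(A 0, A 1)`. -/
structure IsExpansionCone (A : Fin 2 → IntMat) (E : Set Plane) (lamE : ℝ) : Prop where
  isCone : IsCone E
  invariant : ∀ i, Set.MapsTo (planeMap (A i)) E E
  one_lt : 1 < lamE
  expands : ∀ i, ∀ x ∈ E, lamE * ‖x‖ ≤ ‖planeMap (A i) x‖
  transverse : ∀ i, unstableDir (A i) ∩ frontier E = {0}

/-- `C` is a contraction cone with rate `lamC` for the pair `(A 0, A 1)`. -/
structure IsContractionCone (A : Fin 2 → IntMat) (C : Set Plane) (lamC : ℝ) : Prop where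
  isCone : IsCone C
  invariant : ∀ i, Set.MapsTo (planeMap (A i)⁻¹) C C
  pos : 0 < lamC
  lt_one : lamC < 1
  contracts : ∀ i, ∀ x ∈ C, lamC⁻¹ * ‖x‖ ≤ ‖planeMap (A i)⁻¹ x‖
  transverse : ∀ i, stableDir (A i) ∩ frontier C = {0}

/-- The pair `(A 0, A 1)` of hyperbolic toral automorphisms has the cone property, with expansion
cone `E` of rate `lamE` and contraction cone `C` of rate `lamC`. -/
structure HasConeProperty (A : Fin 2 → IntMat) (E C : Set Plane) (lamE lamC : ℝ) : Prop where
  hyperbolic : ∀ i, IsHyperbolic (A i)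
  expansion : IsExpansionCone A E lamE
  contraction : IsContractionCone A C lamC
  inter : E ∩ C = {0}

/-! ### Random compositions -/

/-- The space `{0,1}^ℕ` of environments. -/
abbrev Env := ℕ → Fin 2

/-- The distribution on `{0,1}` giving mass `p` to `0` and mass `1 - p` to `1`. -/
def coin (p : ℝ) : Measure (Fin 2) :=
  ENNReal.ofReal p • Measure.dirac 0 + ENNReal.ofReal (1 - p) • Measure.dirac 1

theorem isProbabilityMeasure_coin {p : ℝ} (hp : p ∈ Set.Ioo (0 : ℝ) 1) :
    IsProbabilityMeasure (coin p) := by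
  constructor
  have h0 : (0 : ℝ) ≤ 1 - p := by linarith [hp.2]
  simp [coin, ← ENNReal.ofReal_add hp.1.le h0]

/-- The Bernoulli product measure on `{0,1}^ℕ`. -/
def envMeasure (p : ℝ) : Measure Env := Measure.infinitePi (fun _ : ℕ => coin p)

/-- The shift `(τω)(k) = ω(k + 1)`. -/
def shift (ω : Env) : Env := fun k => ω (k + 1)

/-- The product `A_ω^n = A_{ω(n-1)} ⋯ A_{ω(0)}`. -/
def cocycle (A : Fin 2 → IntMat) (ω : Env) : ℕ → IntMat
  | 0 => 1
  | n + 1 => A (ω n) * cocycle A ω n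

/-- The skew product `Φ(ω, x) = (τω, A_{ω(0)} x)`. -/
def skew (A : Fin 2 → IntMat) (z : Env × Torus) : Env × Torus :=
  (shift z.1, torusMap (A (z.1 0)) z.2)

/-- The Lyapunov exponents at `ω`: the limits of `n⁻¹ ln |A_ω^n x|` for nonzero `x ∈ ℝ²`. -/
def lyapunovExponents (A : Fin 2 → IntMat) (ω : Env) : Set ℝ :=
  {χ | ∃ x : Plane, x ≠ 0 ∧
    Tendsto (fun n : ℕ => (n : ℝ)⁻¹ * Real.log ‖planeMap (cocycle A ω n) x‖) atTop (𝓝 χ)}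

/-- `χ` is the almost everywhere constant value of the largest Lyapunov exponent. -/
def IsTopLyapunovExponent (A : Fin 2 → IntMat) (p χ : ℝ) : Prop :=
  ∀ᵐ ω ∂(envMeasure p), IsGreatest (lyapunovExponents A ω) χ

/-! ### Observables and correlations -/

/-- The Fourier coefficient `f̂(ω, q) = ∫ e^{-i q·x} f(ω, x) dm(x)`. -/
def fourierCoef (f : Env × Torus → ℂ) (ω : Env) (q : Fin 2 → ℤ) : ℂ :=
  ∫ x, (∏ i, fourier (-(q i)) (x i)) * f (ω, x) ∂torusMeasure

/-- The Euclidean norm of `q ∈ ℤ²`. -/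
def intNorm (q : Fin 2 → ℤ) : ℝ := ‖(WithLp.toLp 2 (fun i => (q i : ℝ)) : Plane)‖

/-- `‖f‖_β = sup_ω ∑_{q ∈ ℤ²} |f̂(ω, q)| |q|^β`, possibly infinite. -/
def holderENorm (β : ℝ) (f : Env × Torus → ℂ) : ℝ≥0∞ :=
  ⨆ ω, ∑' q : Fin 2 → ℤ, ‖fourierCoef f ω q‖ₑ * ENNReal.ofReal (intNorm q ^ β)

/-- `‖f‖_β` as a real number, when finite. -/
def holderNorm (β : ℝ) (f : Env × Torus → ℂ) : ℝ := (holderENorm β f).toReal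

/-- The strong Hölder condition with exponent `β`. Integrability of every `f(ω, ·)` is what makes
the Fourier coefficients meaningful. -/
structure StrongHolder (β : ℝ) (f : Env × Torus → ℂ) : Prop where
  integrable : ∀ ω, Integrable (fun x => f (ω, x)) torusMeasure
  finite : holderENorm β f < ∞

/-- `C_{f,g}(ω,n) = ∫ f(ω, A_ω^n x) g(ω, x) dm(x) - m(f(ω,·)) m(g(ω,·))`. -/
def corr (A : Fin 2 → IntMat) (f g : Env × Torus → ℂ) (ω : Env) (n : ℕ) : ℂ :=
  (∫ x, f (ω, torusMap (cocycle A ω n) x) * g (ω, x) ∂torusMeasure) -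
    (∫ x, f (ω, x) ∂torusMeasure) * (∫ x, g (ω, x) ∂torusMeasure)

/-- `C^Φ_{f,g}(ω,n) = ∫ (f ∘ Φ^n · g)(ω, x) dm(x) - m(f(τ^n ω,·)) m(g(ω,·))`. -/
def corrSkew (A : Fin 2 → IntMat) (f g : Env × Torus → ℂ) (ω : Env) (n : ℕ) : ℂ :=
  (∫ x, f ((skew A)^[n] (ω, x)) * g (ω, x) ∂torusMeasure) -
    (∫ x, f (shift^[n] ω, x) ∂torusMeasure) * (∫ x, g (ω, x) ∂torusMeasure)

end RandomToral

end

/-!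
The proof reduces everything to the growth of products of positive matrices.

*Positive matrices.* In the basis given by two vectors spanning the boundary lines of the expansion
cone `E`, each `A i` preserves the closed double quadrant. Since the unstable directions avoid the
boundary of `E`, the off-diagonal entries do not vanish, and as the determinant is one, all entries
are nonzero and have a common sign (`IsExpansionCone.exists_isPositiveModel`). Up to sign, the
cocycle is thus a product of two positive unimodular matrices. Such products expand vectors of the
quadrant by a factor comparable to their norm, and their inverses do the same on the complementary
quadrant (`Balanced`, `balanced_wordProduct`). An orbit leaves the complementary quadrant for the
quadrant at most once, so an orbit of nonzero integer vectors, which never comes close to the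
origin, satisfies `c ‖A_ω^n‖ ≤ |y| |A_ω^n y|`. In dimension two the transpose is conjugate to the
inverse by a rotation, and therefore also `c ‖A_ω^n‖ ≤ |q| |(A_ω^n)ᵀ q|` for all nonzero
frequencies `q` (`IsPositiveModel.exists_entrySum_le_intNorm`).

*Correlations.* The correlation of `F ∘ M` and `G` is the sum of `F̂(q) Ĝ(-Mᵀ q)` over `q ≠ 0`, so it
is at most `‖F‖_β ‖G‖_β R ^ (-β)` if `R ≤ |q| |Mᵀ q|` for all `q ≠ 0` (`norm_correlation_le`). This
uses that an integrable function with summable Fourier coefficients is the sum of its Fourier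
series (`ae_eq_tsum_torusCoef`). With the bound above, both kinds of correlations are
`O(‖A_ω^n‖ ^ (-β))` (`norm_corr_le`).

*Growth.* The cones give `‖A_ω^n‖ ≥ c (max lamC⁻¹ lamE) ^ n` for every `ω`
(`HasConeProperty.exists_pow_le_entrySum`). For products of positive matrices `ln ‖A_ω^n‖` is
additive up to a bounded error, so the strong law of large numbers on blocks yields its linear growth
at a deterministic rate `χ` (`exists_ae_tendsto_of_almost_additive`), with no need for a subadditive
ergodic theorem. This rate is the largest Lyapunov exponent
(`IsPositiveModel.isGreatest_lyapunovExponents`), and the random constant is the infimum over `n` of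
`‖A_ω^n‖ e^{-(χ - ε) n}`.
-/

noncomputable section

namespace RandomToral

/-! ### Products of positive matrices -/

/-- The `ℓ¹` norm of a vector of `ℝ²`. -/
def l1 (x : Fin 2 → ℝ) : ℝ := |x 0| + |x 1|

/-- The sum of the entries of a `2 × 2` matrix; for nonnegative matrices this is a norm. -/
def entrySum (W : Matrix (Fin 2) (Fin 2) ℝ) : ℝ := W 0 0 + W 0 1 + W 1 0 + W 1 1

/-- A nonnegative matrix whose column sums are comparable up to the factor `κ`, and likewise its
row sums. Comparable column sums make the matrix expand the `ℓ¹` norm on the closed quadrant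
`0 ≤ x 0 * x 1` uniformly, by a factor of the order of its norm; comparable row sums do the same
for the inverse of a matrix of determinant one on the complementary quadrant. -/
structure Balanced (κ : ℝ) (W : Matrix (Fin 2) (Fin 2) ℝ) : Prop where
  nonneg : ∀ i j, 0 ≤ W i j
  col : ∀ i j, W 0 i + W 1 i ≤ κ * (W 0 j + W 1 j)
  row : ∀ i j, W i 0 + W i 1 ≤ κ * (W j 0 + W j 1)

theorem l1_nonneg (x : Fin 2 → ℝ) : 0 ≤ l1 x := by unfold l1; positivity

theorem entrySum_nonneg {W : Matrix (Fin 2) (Fin 2) ℝ} (hW : ∀ i j, 0 ≤ W i j) :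
    0 ≤ entrySum W := by
  unfold entrySum
  linarith [hW 0 0, hW 0 1, hW 1 0, hW 1 1]

theorem mulVec_zero_eq (W : Matrix (Fin 2) (Fin 2) ℝ) (x : Fin 2 → ℝ) :
    (W.mulVec x) 0 = W 0 0 * x 0 + W 0 1 * x 1 := by
  simp [Matrix.mulVec, dotProduct, Fin.sum_univ_two]

theorem mulVec_one_eq (W : Matrix (Fin 2) (Fin 2) ℝ) (x : Fin 2 → ℝ) :
    (W.mulVec x) 1 = W 1 0 * x 0 + W 1 1 * x 1 := by
  simp [Matrix.mulVec, dotProduct, Fin.sum_univ_two]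

theorem mul_apply_two (V W : Matrix (Fin 2) (Fin 2) ℝ) (i j : Fin 2) :
    (V * W) i j = V i 0 * W 0 j + V i 1 * W 1 j := by
  simp [Matrix.mul_apply, Fin.sum_univ_two]

theorem mul_apply_nonneg {V W : Matrix (Fin 2) (Fin 2) ℝ} (hV : ∀ i j, 0 ≤ V i j)
    (hW : ∀ i j, 0 ≤ W i j) (i j : Fin 2) : 0 ≤ (V * W) i j := by
  rw [mul_apply_two]
  have := mul_nonneg (hV i 0) (hW 0 j)
  have := mul_nonneg (hV i 1) (hW 1 j)
  linarith

theorem l1_mulVec_le {W : Matrix (Fin 2) (Fin 2) ℝ} (hW : ∀ i j, 0 ≤ W i j) (x : Fin 2 → ℝ) :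
    l1 (W.mulVec x) ≤ entrySum W * l1 x := by
  have hrow : ∀ i, |W i 0 * x 0 + W i 1 * x 1| ≤ W i 0 * |x 0| + W i 1 * |x 1| := fun i => by
    refine (abs_add_le _ _).trans_eq ?_
    rw [abs_mul, abs_mul, abs_of_nonneg (hW i 0), abs_of_nonneg (hW i 1)]
  unfold l1 entrySum
  rw [mulVec_zero_eq, mulVec_one_eq]
  have h0 := hrow 0
  have h1 := hrow 1
  have := mul_nonneg (hW 0 0) (abs_nonneg (x 1))
  have := mul_nonneg (hW 1 0) (abs_nonneg (x 1))
  have := mul_nonneg (hW 0 1) (abs_nonneg (x 0))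
  have := mul_nonneg (hW 1 1) (abs_nonneg (x 0))
  nlinarith

theorem abs_add_abs_of_mul_nonneg {a b : ℝ} (h : 0 ≤ a * b) : |a + b| = |a| + |b| := by
  rcases mul_nonneg_iff.1 h with ⟨ha, hb⟩ | ⟨ha, hb⟩
  · rw [abs_of_nonneg ha, abs_of_nonneg hb, abs_of_nonneg (add_nonneg ha hb)]
  · rw [abs_of_nonpos ha, abs_of_nonpos hb, abs_of_nonpos (add_nonpos ha hb)]
    ring

theorem abs_combination {a b s t : ℝ} (ha : 0 ≤ a) (hb : 0 ≤ b) (h : 0 ≤ s * t) :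
    |a * s + b * t| = a * |s| + b * |t| := by
  rw [abs_add_abs_of_mul_nonneg, abs_mul, abs_mul, abs_of_nonneg ha, abs_of_nonneg hb]
  have := mul_nonneg (mul_nonneg ha hb) h
  nlinarith

theorem Balanced.entrySum_mul_l1_le {κ : ℝ} {W : Matrix (Fin 2) (Fin 2) ℝ} (hW : Balanced κ W)
    {x : Fin 2 → ℝ} (hx : 0 ≤ x 0 * x 1) :
    entrySum W * l1 x ≤ (1 + κ) * l1 (W.mulVec x) := by
  unfold l1 entrySum
  rw [mulVec_zero_eq, mulVec_one_eq, abs_combination (hW.nonneg 0 0) (hW.nonneg 0 1) hx,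
    abs_combination (hW.nonneg 1 0) (hW.nonneg 1 1) hx]
  have h0 := mul_le_mul_of_nonneg_right (hW.col 1 0) (abs_nonneg (x 0))
  have h1 := mul_le_mul_of_nonneg_right (hW.col 0 1) (abs_nonneg (x 1))
  nlinarith

theorem Balanced.entrySum_mul_l1_mulVec_le {κ : ℝ} {W : Matrix (Fin 2) (Fin 2) ℝ}
    (hW : Balanced κ W) (hdet : W.det = 1) {x : Fin 2 → ℝ}
    (hx : (W.mulVec x) 0 * (W.mulVec x) 1 ≤ 0) :
    entrySum W * l1 (W.mulVec x) ≤ (1 + κ) * l1 x := by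
  rw [Matrix.det_fin_two] at hdet
  -- Up to signs, the adjugate is a nonnegative matrix acting on `(z 0, -z 1)`, where `z = W x`.
  have e0 : x 0 = W 1 1 * (W.mulVec x) 0 + W 0 1 * (-(W.mulVec x) 1) := by
    rw [mulVec_zero_eq, mulVec_one_eq]; linear_combination (-x 0) * hdet
  have e1 : -x 1 = W 1 0 * (W.mulVec x) 0 + W 0 0 * (-(W.mulVec x) 1) := by
    rw [mulVec_zero_eq, mulVec_one_eq]; linear_combination (x 1) * hdet
  set z := W.mulVec x
  have hz : 0 ≤ z 0 * (-z 1) := by linarith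
  have a0 : |x 0| = W 1 1 * |z 0| + W 0 1 * |z 1| := by
    rw [e0, abs_combination (hW.nonneg 1 1) (hW.nonneg 0 1) hz, abs_neg]
  have a1 : |x 1| = W 1 0 * |z 0| + W 0 0 * |z 1| := by
    rw [← abs_neg, e1, abs_combination (hW.nonneg 1 0) (hW.nonneg 0 0) hz, abs_neg]
  unfold l1 entrySum
  rw [a0, a1]
  have h0 := mul_le_mul_of_nonneg_right (hW.row 0 1) (abs_nonneg (z 0))
  have h1 := mul_le_mul_of_nonneg_right (hW.row 1 0) (abs_nonneg (z 1))
  nlinarith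

theorem entrySum_mul_le {V W : Matrix (Fin 2) (Fin 2) ℝ} (hV : ∀ i j, 0 ≤ V i j)
    (hW : ∀ i j, 0 ≤ W i j) : entrySum (V * W) ≤ entrySum V * entrySum W := by
  simp only [entrySum, mul_apply_two]
  have h : ∀ i k j, 0 ≤ V i k * W k.rev j := fun i k j => mul_nonneg (hV i k) (hW _ j)
  have h00 := h 0 0; have h01 := h 0 1; have h10 := h 1 0; have h11 := h 1 1
  simp only [Fin.forall_fin_two] at h00 h01 h10 h11
  norm_num [Fin.rev] at h00 h01 h10 h11
  nlinarith

theorem Balanced.entrySum_mul_entrySum_le {κ : ℝ} {V W : Matrix (Fin 2) (Fin 2) ℝ}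
    (hV : Balanced κ V) (hW : ∀ i j, 0 ≤ W i j) :
    entrySum V * entrySum W ≤ (1 + κ) * entrySum (V * W) := by
  simp only [entrySum, mul_apply_two]
  have h0 := mul_le_mul_of_nonneg_right (hV.col 1 0) (add_nonneg (hW 0 0) (hW 0 1))
  have h1 := mul_le_mul_of_nonneg_right (hV.col 0 1) (add_nonneg (hW 1 0) (hW 1 1))
  nlinarith

/-- The product `Q (ω (n-1)) ⋯ Q (ω 0)` of real matrices along an environment. -/
def wordProduct (Q : Fin 2 → Matrix (Fin 2) (Fin 2) ℝ) (ω : Env) :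
    ℕ → Matrix (Fin 2) (Fin 2) ℝ
  | 0 => 1
  | n + 1 => Q (ω n) * wordProduct Q ω n

theorem shift_iterate_apply (m : ℕ) (ω : Env) (k : ℕ) : (shift^[m] ω) k = ω (k + m) := by
  induction m generalizing ω with
  | zero => rfl
  | succ m ih => rw [Function.iterate_succ_apply, ih, shift, add_assoc]

theorem wordProduct_add (Q : Fin 2 → Matrix (Fin 2) (Fin 2) ℝ) (ω : Env) (m n : ℕ) :
    wordProduct Q ω (m + n) = wordProduct Q (shift^[m] ω) n * wordProduct Q ω m := by
  induction n with
  | zero => simp [wordProduct]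
  | succ n ih =>
    rw [← add_assoc, wordProduct, ih, wordProduct, shift_iterate_apply, Matrix.mul_assoc,
      add_comm m n]

theorem det_wordProduct {Q : Fin 2 → Matrix (Fin 2) (Fin 2) ℝ} (hdet : ∀ i, (Q i).det = 1)
    (ω : Env) (n : ℕ) : (wordProduct Q ω n).det = 1 := by
  induction n with
  | zero => simp [wordProduct]
  | succ n ih => rw [wordProduct, Matrix.det_mul, ih, hdet, one_mul]

theorem exists_entry_ratio_bound {Q : Fin 2 → Matrix (Fin 2) (Fin 2) ℝ}
    (hQ : ∀ i a b, 0 < Q i a b) :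
    ∃ κ : ℝ, 1 ≤ κ ∧ ∀ i a b c d, Q i a b ≤ κ * Q i c d := by
  have hpos : ∀ t : Fin 2 × (Fin 2 × Fin 2) × (Fin 2 × Fin 2),
      0 ≤ Q t.1 t.2.1.1 t.2.1.2 / Q t.1 t.2.2.1 t.2.2.2 :=
    fun t => div_nonneg (hQ _ _ _).le (hQ _ _ _).le
  refine ⟨1 + ∑ t : Fin 2 × (Fin 2 × Fin 2) × (Fin 2 × Fin 2),
    Q t.1 t.2.1.1 t.2.1.2 / Q t.1 t.2.2.1 t.2.2.2,
    le_add_of_nonneg_right (Finset.sum_nonneg fun t _ => hpos t), fun i a b c d => ?_⟩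
  rw [← div_le_iff₀ (hQ i c d)]
  have := Finset.single_le_sum (fun t _ => hpos t) (Finset.mem_univ (i, (a, b), (c, d)))
  simp only at this
  linarith

/-- All products of a finite set of positive matrices are balanced with one and the same constant:
the column sums are compared through the factor applied first, the row sums through the factor
applied last. -/
theorem balanced_wordProduct {Q : Fin 2 → Matrix (Fin 2) (Fin 2) ℝ} {κ : ℝ}
    (hQ : ∀ i a b, 0 < Q i a b) (hκ : 1 ≤ κ) (hr : ∀ i a b c d, Q i a b ≤ κ * Q i c d)
    (ω : Env) (n : ℕ) : Balanced κ (wordProduct Q ω n) := by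
  have hnn : ∀ (ω : Env) n i j, 0 ≤ wordProduct Q ω n i j := by
    intro ω n
    induction n with
    | zero => intro i j; simp only [wordProduct, Matrix.one_apply]; split_ifs <;> norm_num
    | succ n ih => exact mul_apply_nonneg (fun i j => (hQ _ i j).le) ih
  rcases n with _ | n
  · refine ⟨hnn ω 0, ?_, ?_⟩ <;>
      simp only [wordProduct, Fin.forall_fin_two] <;> simp [hκ]
  refine ⟨hnn ω (n + 1), fun i j => ?_, fun i j => ?_⟩
  · have e : wordProduct Q ω (n + 1) = wordProduct Q (shift ω) n * Q (ω 0) := by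
      rw [add_comm, wordProduct_add]
      simp [wordProduct]
    rw [e]
    simp only [mul_apply_two]
    have hW := hnn (shift ω) n
    have h0 := mul_le_mul_of_nonneg_left (hr (ω 0) 0 i 0 j) (add_nonneg (hW 0 0) (hW 1 0))
    have h1 := mul_le_mul_of_nonneg_left (hr (ω 0) 1 i 1 j) (add_nonneg (hW 0 1) (hW 1 1))
    linarith
  · simp only [wordProduct, mul_apply_two]
    have hW := hnn ω n
    have h0 := mul_le_mul_of_nonneg_right (hr (ω n) i 0 j 0) (add_nonneg (hW 0 0) (hW 0 1))
    have h1 := mul_le_mul_of_nonneg_right (hr (ω n) i 1 j 1) (add_nonneg (hW 1 0) (hW 1 1))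
    linarith

theorem exists_lt_not_and_succ {p : ℕ → Prop} {n : ℕ} (h0 : ¬ p 0) (hn : p n) :
    ∃ k < n, ¬ p k ∧ p (k + 1) := by
  induction n with
  | zero => exact absurd hn h0
  | succ n ih =>
    by_cases h : p n
    · obtain ⟨k, hk, hk'⟩ := ih h
      exact ⟨k, hk.trans n.lt_succ_self, hk'⟩
    · exact ⟨n, n.lt_succ_self, h, hn⟩

/-- If an orbit stays at distance at least `r` from the origin, the product of the norms of its end
points is at least of the order of the norm of the matrix product. Indeed such an orbit is
contracted at the maximal rate as long as it is outside of the quadrant, and expanded at the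
maximal rate once it is inside. -/
theorem exists_entrySum_wordProduct_le {Q : Fin 2 → Matrix (Fin 2) (Fin 2) ℝ}
    (hQ : ∀ i a b, 0 < Q i a b) (hdet : ∀ i, (Q i).det = 1) {r : ℝ} (hr : 0 < r) :
    ∃ c : ℝ, 0 < c ∧ ∀ (ω : Env) (n : ℕ) (x : Fin 2 → ℝ),
      (∀ k ≤ n, r ≤ l1 ((wordProduct Q ω k).mulVec x)) →
      c * entrySum (wordProduct Q ω n) ≤ l1 x * l1 ((wordProduct Q ω n).mulVec x) := by
  obtain ⟨κ, hκ, hκr⟩ := exists_entry_ratio_bound hQ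
  have hbal := balanced_wordProduct hQ hκ hκr
  have hsum : ∀ i, 0 ≤ entrySum (Q i) := fun i => entrySum_nonneg fun a b => (hQ i a b).le
  set M : ℝ := 1 + entrySum (Q 0) + entrySum (Q 1) with hM
  have hM1 : 1 ≤ M := by linarith [hsum 0, hsum 1]
  have hMle : ∀ i, entrySum (Q i) ≤ M := by
    rw [Fin.forall_fin_two]
    constructor <;> linarith [hsum 0, hsum 1]
  have hκ0 : 0 < 1 + κ := by linarith
  -- The two halves of the orbit lose a factor `1 + κ` each, the step between them a factor `M`.
  refine ⟨r ^ 2 / ((1 + κ) ^ 2 * M), by positivity, fun ω n x hx => ?_⟩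
  rw [div_mul_eq_mul_div, div_le_iff₀ (by positivity)]
  set N := entrySum (wordProduct Q ω n) with hN
  have hN0 : 0 ≤ N := entrySum_nonneg (hbal ω n).nonneg
  have hx0 : r ≤ l1 x := by simpa [wordProduct] using hx 0 n.zero_le
  have hxn := hx n le_rfl
  have hfac : (1 + κ) ≤ (1 + κ) ^ 2 * M := by nlinarith
  have hl0 := l1_nonneg x
  have hln := l1_nonneg ((wordProduct Q ω n).mulVec x)
  let p : ℕ → Prop := fun k =>
    0 ≤ ((wordProduct Q ω k).mulVec x) 0 * ((wordProduct Q ω k).mulVec x) 1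
  by_cases h0 : p 0
  · have h := (hbal ω n).entrySum_mul_l1_le (x := x) (by simpa [p, wordProduct] using h0)
    calc r ^ 2 * N ≤ l1 x * (N * l1 x) := by nlinarith [mul_le_mul hx0 hx0 hr.le hl0]
      _ ≤ l1 x * ((1 + κ) * l1 ((wordProduct Q ω n).mulVec x)) := by gcongr
      _ = l1 x * l1 ((wordProduct Q ω n).mulVec x) * (1 + κ) := by ring
      _ ≤ _ := by gcongr
  by_cases hn : p n
  · obtain ⟨k, hk, hk0, hk1⟩ := exists_lt_not_and_succ h0 hn
    obtain ⟨m, rfl⟩ : ∃ m, n = (k + 1) + m := ⟨n - (k + 1), by omega⟩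
    have h1 := (hbal ω k).entrySum_mul_l1_mulVec_le (det_wordProduct hdet ω k) (not_le.1 hk0).le
    have h2 := (hbal (shift^[k + 1] ω) m).entrySum_mul_l1_le hk1
    rw [Matrix.mulVec_mulVec, ← wordProduct_add] at h2
    have hr1 := hx k (by omega)
    have hr2 := hx (k + 1) (by omega)
    have hNle : N ≤ entrySum (wordProduct Q (shift^[k + 1] ω) m) *
        (M * entrySum (wordProduct Q ω k)) := by
      rw [hN, wordProduct_add, wordProduct]
      refine (entrySum_mul_le (hbal _ _).nonneg (hbal ω (k + 1)).nonneg).trans ?_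
      gcongr
      · exact entrySum_nonneg (hbal _ _).nonneg
      · refine (entrySum_mul_le (fun a b => (hQ _ a b).le) (hbal ω k).nonneg).trans ?_
        gcongr
        · exact entrySum_nonneg (hbal _ _).nonneg
        · exact hMle _
    have hk := entrySum_nonneg (hbal ω k).nonneg
    have hm := entrySum_nonneg (hbal (shift^[k + 1] ω) m).nonneg
    set a := entrySum (wordProduct Q ω k)
    set b := entrySum (wordProduct Q (shift^[k + 1] ω) m)
    set y := l1 ((wordProduct Q ω k).mulVec x)
    set z := l1 ((wordProduct Q ω (k + 1)).mulVec x)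
    set w := l1 ((wordProduct Q ω (k + 1 + m)).mulVec x)
    have h3 : (a * y) * (b * z) ≤ ((1 + κ) * l1 x) * ((1 + κ) * w) :=
      mul_le_mul h1 h2 (mul_nonneg hm (hr.le.trans hr2)) (mul_nonneg hκ0.le hl0)
    have h4 : r * r ≤ y * z := mul_le_mul hr1 hr2 hr.le (hr.le.trans hr1)
    calc r ^ 2 * N ≤ r ^ 2 * (b * (M * a)) := by gcongr
      _ = M * (a * b) * (r * r) := by ring
      _ ≤ M * (a * b) * (y * z) := by gcongr
      _ = M * ((a * y) * (b * z)) := by ring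
      _ ≤ M * (((1 + κ) * l1 x) * ((1 + κ) * w)) := by gcongr
      _ = _ := by ring
  · have h := (hbal ω n).entrySum_mul_l1_mulVec_le (det_wordProduct hdet ω n) (not_le.1 hn).le
    set w := l1 ((wordProduct Q ω n).mulVec x)
    calc r ^ 2 * N ≤ (N * w) * w := by nlinarith [mul_le_mul hxn hxn hr.le hln]
      _ ≤ ((1 + κ) * l1 x) * w := by gcongr
      _ = l1 x * w * (1 + κ) := by ring
      _ ≤ _ := by gcongr

/-! ### Matrices preserving a cone are positive up to sign -/

theorem planeMap_mul_apply (M N : IntMat) (x : Plane) :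
    planeMap (M * N) x = planeMap M (planeMap N x) := by
  have h : (M * N).map (fun z : ℤ => (z : ℝ)) =
      M.map (fun z : ℤ => (z : ℝ)) * N.map (fun z : ℤ => (z : ℝ)) :=
    Matrix.map_mul (f := Int.castRingHom ℝ)
  simp only [planeMap, h, Matrix.toLpLin_mul_same, LinearMap.comp_apply]

theorem planeMap_one_apply (x : Plane) : planeMap 1 x = x := by
  have h : (1 : IntMat).map (fun z : ℤ => (z : ℝ)) = 1 :=
    Matrix.map_one _ Int.cast_zero Int.cast_one
  simp only [planeMap, h, Matrix.toLpLin_one, LinearMap.id_apply]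

theorem det_planeMap (M : IntMat) : LinearMap.det (planeMap M) = (M.det : ℝ) := by
  rw [planeMap, LinearMap.det_toLpLin]
  exact ((Int.castRingHom ℝ).map_det M).symm

theorem nonneg_of_forall_pos {φ : ℝ → ℝ} (hφ : Continuous φ) (h : ∀ t, 0 < t → 0 ≤ φ t) :
    0 ≤ φ 0 :=
  ge_of_tendsto (hφ.continuousWithinAt (s := Set.Ioi 0) (x := 0))
    (eventually_nhdsWithin_of_forall fun t ht => h t ht)

/-- The boundary line `ℝu` of the double sector between `ℝu` and `ℝv` consists of frontier
points, whether or not it belongs to the sector. -/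
theorem mem_frontier_of_sector {E : Set Plane} {u v : Plane}
    (hin : ∀ a b : ℝ, 0 < a * b → a • u + b • v ∈ E)
    (hout : ∀ a b : ℝ, a • u + b • v ∈ E → 0 ≤ a * b) : u ∈ frontier E := by
  have hcont : Continuous fun t : ℝ => u + t • v := by fun_prop
  have ht : Tendsto (fun t : ℝ => u + t • v) (𝓝 0) (𝓝 u) := by
    simpa using hcont.tendsto 0
  refine ⟨mem_closure_of_tendsto (ht.mono_left (nhdsWithin_le_nhds (s := Set.Ioi 0))) ?_, ?_⟩
  · filter_upwards [self_mem_nhdsWithin] with t ht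
    simpa using hin 1 t (by simpa using ht)
  · intro hu
    have hev := (ht.eventually (isOpen_interior.mem_nhds hu)).filter_mono
      (nhdsWithin_le_nhds (s := Set.Iio 0))
    obtain ⟨t, htE, ht0⟩ := (hev.and self_mem_nhdsWithin).exists
    have := hout 1 t (by simpa using interior_subset htE)
    rw [one_mul] at this
    exact absurd ht0 (not_lt.2 this)

/-- An expanded boundary line of an expansion cone is not invariant, for otherwise it would be an
unstable direction. -/
theorem coord_ne_zero_of_transverse {E : Set Plane} {u v : Plane} {M : IntMat} {lam a b : ℝ}
    (hu : u ≠ 0) (hin : ∀ a b : ℝ, 0 < a * b → a • u + b • v ∈ E)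
    (hout : ∀ a b : ℝ, a • u + b • v ∈ E → 0 ≤ a * b) (hlam : 1 < lam)
    (hexp : ∀ x ∈ E, lam * ‖x‖ ≤ ‖planeMap M x‖) (htr : unstableDir M ∩ frontier E = {0})
    (hM : planeMap M u = a • u + b • v) : b ≠ 0 := by
  rintro rfl
  rw [zero_smul, add_zero] at hM
  have hcont : Continuous (planeMap M) := LinearMap.continuous_of_finiteDimensional _
  have h := nonneg_of_forall_pos
    (φ := fun t : ℝ => ‖planeMap M (u + t • v)‖ - lam * ‖u + t • v‖) (by fun_prop)
    fun t ht => by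
      have := hexp _ (hin 1 t (by simpa using ht))
      rw [one_smul] at this
      linarith
  simp only [zero_smul, add_zero, hM, norm_smul, Real.norm_eq_abs] at h
  have hpos := norm_pos_iff.2 hu
  have ha : 1 < |a| := by nlinarith
  have : u ∈ unstableDir M ∩ frontier E := ⟨⟨a, ha, hM⟩, mem_frontier_of_sector hin hout⟩
  rw [htr] at this
  exact hu this

/-- A matrix of determinant one with nonzero off-diagonal entries that maps the closed double
quadrant into itself has, up to a global sign, positive entries. -/
theorem exists_sign_of_preserves_quadrant {P : Matrix (Fin 2) (Fin 2) ℝ} (hdet : P.det = 1)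
    (hb : P 1 0 ≠ 0) (hc : P 0 1 ≠ 0)
    (hP : ∀ s t : ℝ, 0 < s * t → 0 ≤ (P 0 0 * s + P 0 1 * t) * (P 1 0 * s + P 1 1 * t)) :
    ∃ ε : ℝ, (ε = 1 ∨ ε = -1) ∧ ∀ i j, 0 < ε * P i j := by
  obtain ⟨a, b, c, d, rfl⟩ : ∃ a b c d, P = !![a, c; b, d] :=
    ⟨_, _, _, _, Matrix.eta_fin_two P⟩
  simp only [Matrix.det_fin_two_of, Matrix.of_apply, Matrix.cons_val', Matrix.cons_val_zero,
    Matrix.cons_val_one, Matrix.cons_val_fin_one] at hdet hb hc hP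
  have hab : 0 ≤ a * b := by
    have := nonneg_of_forall_pos (φ := fun t : ℝ => (a + c * t) * (b + d * t)) (by fun_prop)
      fun t ht => by simpa using hP 1 t (by simpa using ht)
    simpa using this
  have hcd : 0 ≤ c * d := by
    have := nonneg_of_forall_pos (φ := fun t : ℝ => (a * t + c) * (b * t + d)) (by fun_prop)
      fun t ht => by simpa using hP t 1 (by simpa using ht)
    simpa using this
  have hlast : ∀ ε : ℝ, 0 < ε * a → 0 < ε * b → 0 < ε * c → 0 < ε * d →
      ∀ i j, 0 < ε * !![a, c; b, d] i j := by
    intro ε h1 h2 h3 h4 i j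
    fin_cases i <;> fin_cases j <;> simpa
  rcases lt_or_gt_of_ne hb with hb | hb <;> rcases lt_or_gt_of_ne hc with hc | hc
  · have ha : a < 0 := by
      rcases lt_trichotomy a 0 with h | rfl | h
      · exact h
      · nlinarith
      · nlinarith
    have hd : d < 0 := by nlinarith
    exact ⟨-1, Or.inr rfl, hlast _ (by linarith) (by linarith) (by linarith) (by linarith)⟩
  · -- Otherwise the quadrant contains a vector that is mapped to `(1, -1)`.
    have ha : a ≤ 0 := by nlinarith
    have hd : 0 ≤ d := by nlinarith
    have := hP (c + d) (-(a + b)) (by nlinarith)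
    nlinarith
  · have ha : 0 ≤ a := by nlinarith
    have hd : d ≤ 0 := by nlinarith
    have := hP (-c - d) (a + b) (by nlinarith)
    nlinarith
  · have ha : 0 < a := by
      rcases lt_trichotomy a 0 with h | rfl | h
      · nlinarith
      · nlinarith
      · exact h
    have hd : 0 < d := by nlinarith
    exact ⟨1, Or.inl rfl, hlast _ (by linarith) (by linarith) (by linarith) (by linarith)⟩

/-- `Q` and `e` form a positive model of the pair `A`: in the coordinates `e`, every product
`A_ω^n` is, up to sign, the corresponding product of the positive unimodular matrices `Q 0`,
`Q 1`. -/
structure IsPositiveModel (A : Fin 2 → IntMat) (Q : Fin 2 → Matrix (Fin 2) (Fin 2) ℝ)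
    (e : (Fin 2 → ℝ) ≃ₗ[ℝ] Plane) : Prop where
  pos : ∀ i a b, 0 < Q i a b
  det : ∀ i, (Q i).det = 1
  semiconj : ∀ ω n x, planeMap (cocycle A ω n) (e x) = e ((wordProduct Q ω n).mulVec x) ∨
    planeMap (cocycle A ω n) (e x) = -e ((wordProduct Q ω n).mulVec x)

/-- A pair of unimodular matrices with an expansion cone has a positive model, whose coordinates
are those with respect to the boundary lines of the cone. -/
theorem IsExpansionCone.exists_isPositiveModel {A : Fin 2 → IntMat} {E : Set Plane} {lamE : ℝ}
    (hE : IsExpansionCone A E lamE) (hdet : ∀ i, (A i).det = 1) :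
    ∃ Q e, IsPositiveModel A Q e := by
  obtain ⟨-, u, v, hli, hinE, hEin⟩ := hE.isCone
  have hcard : Fintype.card (Fin 2) = Module.finrank ℝ Plane := by simp
  let b := basisOfLinearIndependentOfCardEqFinrank hli hcard
  have hb : ⇑b = ![u, v] := coe_basisOfLinearIndependentOfCardEqFinrank hli hcard
  let e := b.equivFun.symm
  have he : ∀ x, e x = x 0 • u + x 1 • v := fun x => by
    simp [e, Module.Basis.equivFun_symm_apply, Fin.sum_univ_two, hb]
  have hin : ∀ s t : ℝ, 0 < s * t → s • u + t • v ∈ E := fun s t h => hinE ⟨s, t, h, rfl⟩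
  have hout : ∀ s t : ℝ, s • u + t • v ∈ E → 0 ≤ s * t := by
    intro s t h
    obtain ⟨s', t', h', heq⟩ := hEin h
    have : e ![s, t] = e ![s', t'] := by simpa [he] using heq
    have := e.injective this
    have h0 := congrFun this 0
    have h1 := congrFun this 1
    simp only [Matrix.cons_val_zero, Matrix.cons_val_one] at h0 h1
    rwa [h0, h1]
  have hu : u ≠ 0 := by simpa using hli.ne_zero 0
  have hv : v ≠ 0 := by simpa using hli.ne_zero 1
  let P : Fin 2 → Matrix (Fin 2) (Fin 2) ℝ := fun i => LinearMap.toMatrix b b (planeMap (A i))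
  have hP : ∀ i x, planeMap (A i) (e x) = e ((P i).mulVec x) := fun i x => by
    apply b.equivFun.injective
    have h := LinearMap.toMatrix_mulVec_repr b b (planeMap (A i)) (e x)
    have h' : ⇑(b.repr (e x)) = x := b.equivFun.apply_symm_apply x
    rw [h'] at h
    rw [LinearEquiv.apply_symm_apply]
    exact h.symm
  have hPdet : ∀ i, (P i).det = 1 := fun i => by
    rw [LinearMap.det_toMatrix, det_planeMap, hdet, Int.cast_one]
  have hMu : ∀ i, planeMap (A i) u = P i 0 0 • u + P i 1 0 • v := fun i => by
    simpa [he, mulVec_zero_eq, mulVec_one_eq] using hP i ![1, 0]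
  have hMv : ∀ i, planeMap (A i) v = P i 1 1 • v + P i 0 1 • u := fun i => by
    rw [add_comm]
    simpa [he, mulVec_zero_eq, mulVec_one_eq] using hP i ![0, 1]
  have hsign : ∀ i, ∃ ε : ℝ, (ε = 1 ∨ ε = -1) ∧ ∀ j k, 0 < ε * P i j k := by
    intro i
    refine exists_sign_of_preserves_quadrant (hPdet i) ?_ ?_ fun s t hst => ?_
    · exact coord_ne_zero_of_transverse hu hin hout hE.one_lt (hE.expands i) (hE.transverse i)
        (hMu i)
    · refine coord_ne_zero_of_transverse hv (fun s t h => ?_) (fun s t h => ?_) hE.one_lt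
        (hE.expands i) (hE.transverse i) (hMv i)
      · rw [add_comm]; exact hin t s (by rwa [mul_comm])
      · rw [mul_comm]; exact hout t s (by rwa [add_comm])
    · apply hout
      have := hE.invariant i (hin s t hst)
      have h2 := hP i ![s, t]
      simp only [he, mulVec_zero_eq, mulVec_one_eq, Matrix.cons_val_zero,
        Matrix.cons_val_one] at h2
      rwa [h2] at this
  choose ε hε hpos using hsign
  refine ⟨fun i => ε i • P i, e, ⟨fun i j k => hpos i j k, fun i => ?_, fun ω n x => ?_⟩⟩
  · rw [Matrix.det_smul, hPdet]
    rcases hε i with h | h <;> simp [h]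
  · induction n with
    | zero => left; simp [cocycle, wordProduct, planeMap_one_apply]
    | succ n ih =>
      have key : ∀ y, planeMap (A (ω n)) (e y) = e ((ε (ω n) • P (ω n)).mulVec y) ∨
          planeMap (A (ω n)) (e y) = -e ((ε (ω n) • P (ω n)).mulVec y) := fun y => by
        rcases hε (ω n) with h | h
        · left; rw [hP, h, one_smul]
        · right; rw [hP, h, neg_one_smul, Matrix.neg_mulVec, map_neg, neg_neg]
      rw [cocycle, wordProduct, planeMap_mul_apply, ← Matrix.mulVec_mulVec]
      rcases ih with ih | ih <;> rw [ih]
      · exact key _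
      · rw [map_neg, neg_inj, neg_eq_iff_eq_neg]
        exact (key _).symm
/-! ### Growth of the cocycle and of integer orbits -/

theorem exists_l1_bounds (e : (Fin 2 → ℝ) ≃ₗ[ℝ] Plane) :
    ∃ K : ℝ, 0 < K ∧ ∀ x, ‖e x‖ ≤ K * l1 x ∧ l1 x ≤ K * ‖e x‖ := by
  let L := e.toContinuousLinearEquiv
  have hsup : ∀ x : Fin 2 → ℝ, ‖x‖ ≤ l1 x := fun x => by
    refine (pi_norm_le_iff_of_nonneg (l1_nonneg x)).2 ?_
    rw [Fin.forall_fin_two]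
    exact ⟨le_add_of_nonneg_right (abs_nonneg _), le_add_of_nonneg_left (abs_nonneg _)⟩
  have hl1 : ∀ x : Fin 2 → ℝ, l1 x ≤ 2 * ‖x‖ := fun x => by
    have h0 := norm_le_pi_norm x 0
    have h1 := norm_le_pi_norm x 1
    rw [Real.norm_eq_abs] at h0 h1
    unfold l1
    linarith
  have h1 : ∀ x, ‖e x‖ ≤ ‖(L : (Fin 2 → ℝ) →L[ℝ] Plane)‖ * ‖x‖ :=
    fun x => (L : (Fin 2 → ℝ) →L[ℝ] Plane).le_opNorm x
  have h2 : ∀ x, ‖x‖ ≤ ‖(L.symm : Plane →L[ℝ] (Fin 2 → ℝ))‖ * ‖e x‖ := fun x => by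
    have : ‖L.symm (L x)‖ ≤ _ := (L.symm : Plane →L[ℝ] (Fin 2 → ℝ)).le_opNorm (L x)
    rwa [L.symm_apply_apply] at this
  set a := ‖(L : (Fin 2 → ℝ) →L[ℝ] Plane)‖
  set b := ‖(L.symm : Plane →L[ℝ] (Fin 2 → ℝ))‖
  have ha : 0 ≤ a := norm_nonneg _
  have hb : 0 ≤ b := norm_nonneg _
  refine ⟨1 + a + 2 * b, by positivity, fun x => ⟨?_, ?_⟩⟩
  · refine (h1 x).trans ?_
    have := l1_nonneg x
    gcongr
    · linarith
    · exact hsup x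
  · have := norm_nonneg (e x)
    nlinarith [hl1 x, h2 x]

theorem IsPositiveModel.norm_planeMap {A : Fin 2 → IntMat}
    {Q : Fin 2 → Matrix (Fin 2) (Fin 2) ℝ} {e : (Fin 2 → ℝ) ≃ₗ[ℝ] Plane}
    (h : IsPositiveModel A Q e) (ω : Env) (n : ℕ) (x : Fin 2 → ℝ) :
    ‖planeMap (cocycle A ω n) (e x)‖ = ‖e ((wordProduct Q ω n).mulVec x)‖ := by
  rcases h.semiconj ω n x with h | h <;> rw [h]
  rw [norm_neg]

theorem det_cocycle {A : Fin 2 → IntMat} (hdet : ∀ i, (A i).det = 1) (ω : Env) (n : ℕ) :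
    (cocycle A ω n).det = 1 := by
  induction n with
  | zero => simp [cocycle]
  | succ n ih => rw [cocycle, Matrix.det_mul, ih, hdet, one_mul]

theorem intNorm_mulVec (M : IntMat) (y : Fin 2 → ℤ) :
    intNorm (M.mulVec y) = ‖planeMap M (WithLp.toLp 2 fun i => (y i : ℝ))‖ := by
  rw [intNorm, planeMap, Matrix.toLpLin_toLp]
  congr 2
  ext i
  exact RingHom.map_mulVec (Int.castRingHom ℝ) M y i

theorem intNorm_nonneg (q : Fin 2 → ℤ) : 0 ≤ intNorm q := norm_nonneg _

theorem one_le_intNorm {q : Fin 2 → ℤ} (hq : q ≠ 0) : 1 ≤ intNorm q := by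
  obtain ⟨i, hi⟩ := Function.ne_iff.1 hq
  have h1 : (1 : ℝ) ≤ |(q i : ℝ)| := by exact_mod_cast Int.one_le_abs hi
  exact h1.trans (PiLp.norm_apply_le (WithLp.toLp 2 fun i => (q i : ℝ) : Plane) i)

theorem mulVec_ne_zero_of_det {M : IntMat} (hM : M.det = 1) {y : Fin 2 → ℤ} (hy : y ≠ 0) :
    M.mulVec y ≠ 0 := fun h =>
  hy (Matrix.eq_zero_of_mulVec_eq_zero (by rw [hM]; exact one_ne_zero) h)

/-- The transpose of a unimodular `2 × 2` matrix is conjugate to its inverse by the rotation of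
angle `π / 2`, so that lower bounds for `|y| |M y|` on the integer lattice are the same as lower
bounds for `|q| |Mᵀ q|`. -/
theorem intNorm_mul_intNorm_transpose {M : IntMat} (hM : M.det = 1) {R : ℝ}
    (h : ∀ y : Fin 2 → ℤ, y ≠ 0 → R ≤ intNorm y * intNorm (M.mulVec y)) {q : Fin 2 → ℤ}
    (hq : q ≠ 0) : R ≤ intNorm q * intNorm (M.transpose.mulVec q) := by
  have hrot : ∀ w : Fin 2 → ℤ, intNorm ![-w 1, w 0] = intNorm w := fun w => by
    simp [intNorm, EuclideanSpace.norm_eq, Fin.sum_univ_two, add_comm]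
  set w := M.transpose.mulVec q with hw
  have hw0 : w ≠ 0 := mulVec_ne_zero_of_det (by rwa [Matrix.det_transpose]) hq
  have hMw : M.mulVec ![-w 1, w 0] = ![-q 1, q 0] := by
    rw [Matrix.det_fin_two] at hM
    ext i
    fin_cases i <;>
      simp [hw, Matrix.mulVec, dotProduct, Fin.sum_univ_two]
    · linear_combination (-q 1) * hM
    · linear_combination (q 0) * hM
  have hne : (![-w 1, w 0] : Fin 2 → ℤ) ≠ 0 := fun h0 => hw0 <| by
    have h1 := congrFun h0 0
    have h2 := congrFun h0 1
    ext i
    fin_cases i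
    · simpa using h2
    · simpa using h1
  have := h _ hne
  rwa [hMw, hrot, hrot, mul_comm] at this

/-- Frequencies cannot be small both before and after the action of `A_ω^n`: the nonzero integer
points stay away from the origin, so their orbits obey `exists_entrySum_wordProduct_le`. -/
theorem IsPositiveModel.exists_entrySum_le_intNorm {A : Fin 2 → IntMat}
    {Q : Fin 2 → Matrix (Fin 2) (Fin 2) ℝ} {e : (Fin 2 → ℝ) ≃ₗ[ℝ] Plane}
    (h : IsPositiveModel A Q e) (hdet : ∀ i, (A i).det = 1) :
    ∃ c : ℝ, 0 < c ∧ ∀ (ω : Env) (n : ℕ) (q : Fin 2 → ℤ), q ≠ 0 →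
      c * entrySum (wordProduct Q ω n) ≤
        intNorm q * intNorm ((cocycle A ω n).transpose.mulVec q) := by
  obtain ⟨K, hK, hKe⟩ := exists_l1_bounds e
  obtain ⟨c, hc, hcQ⟩ := exists_entrySum_wordProduct_le h.pos h.det (inv_pos.2 hK)
  refine ⟨c / K ^ 2, by positivity, fun ω n q hq =>
    intNorm_mul_intNorm_transpose (det_cocycle hdet ω n) (fun y hy => ?_) hq⟩
  set x := e.symm (WithLp.toLp 2 fun i => (y i : ℝ)) with hx
  have hex : e x = WithLp.toLp 2 fun i => (y i : ℝ) := e.apply_symm_apply _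
  have hn : ∀ k, intNorm ((cocycle A ω k).mulVec y) = ‖e ((wordProduct Q ω k).mulVec x)‖ :=
    fun k => by rw [intNorm_mulVec, ← hex, h.norm_planeMap]
  have h0 : intNorm y = ‖e x‖ := by rw [hex]; rfl
  have horb := hcQ ω n x fun k _ => by
    have h1 := one_le_intNorm (mulVec_ne_zero_of_det (det_cocycle hdet ω k) hy)
    rw [hn] at h1
    have h2 := (hKe ((wordProduct Q ω k).mulVec x)).1
    rw [inv_le_iff_one_le_mul₀ hK]
    linarith
  rw [div_mul_eq_mul_div, div_le_iff₀ (by positivity), hn, h0]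
  calc _ ≤ _ := horb
    _ ≤ (K * ‖e x‖) * (K * ‖e ((wordProduct Q ω n).mulVec x)‖) :=
      mul_le_mul (hKe x).2 (hKe _).2 (l1_nonneg _) (by positivity)
    _ = _ := by ring

theorem l1_le_entrySum_mul {W : Matrix (Fin 2) (Fin 2) ℝ} (hW : ∀ i j, 0 ≤ W i j)
    (hdet : W.det = 1) (x : Fin 2 → ℝ) : l1 x ≤ entrySum W * l1 (W.mulVec x) := by
  let V : Matrix (Fin 2) (Fin 2) ℝ := !![W 1 1, W 0 1; W 1 0, W 0 0]
  have hV : ∀ i j, 0 ≤ V i j := by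
    simp only [V, Fin.forall_fin_two]
    exact ⟨⟨hW 1 1, hW 0 1⟩, ⟨hW 1 0, hW 0 0⟩⟩
  have h := l1_mulVec_le hV ![W.mulVec x 0, -W.mulVec x 1]
  have e : V.mulVec ![W.mulVec x 0, -W.mulVec x 1] = ![x 0, -x 1] := by
    rw [Matrix.det_fin_two] at hdet
    ext i
    fin_cases i <;> simp [V, Matrix.mulVec, dotProduct, Fin.sum_univ_two]
    · linear_combination (x 0) * hdet
    · linear_combination (-x 1) * hdet
  rw [e] at h
  have hs : entrySum V = entrySum W := by simp [entrySum, V]; ring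
  rw [hs] at h
  simpa only [l1, Matrix.cons_val_zero, Matrix.cons_val_one, abs_neg] using h

theorem exists_mem_ne_zero_of_isCone {S : Set Plane} (hS : IsCone S) : ∃ x ∈ S, x ≠ 0 := by
  obtain ⟨-, u, v, hli, hin, -⟩ := hS
  refine ⟨u + v, hin ⟨1, 1, by norm_num, by simp⟩, fun h => ?_⟩
  have := (LinearIndependent.pair_iff.1 hli 1 1 (by simpa using h)).1
  exact one_ne_zero this

theorem IsExpansionCone.mem_and_pow_le {A : Fin 2 → IntMat} {E : Set Plane} {lamE : ℝ}
    (hE : IsExpansionCone A E lamE) (ω : Env) (n : ℕ) {x : Plane} (hx : x ∈ E) :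
    planeMap (cocycle A ω n) x ∈ E ∧ lamE ^ n * ‖x‖ ≤ ‖planeMap (cocycle A ω n) x‖ := by
  induction n with
  | zero => simpa [cocycle, planeMap_one_apply] using hx
  | succ n ih =>
    rw [cocycle, planeMap_mul_apply]
    refine ⟨hE.invariant _ ih.1, ?_⟩
    have h0 : 0 ≤ lamE := by linarith [hE.one_lt]
    calc lamE ^ (n + 1) * ‖x‖ = lamE * (lamE ^ n * ‖x‖) := by ring
      _ ≤ lamE * ‖planeMap (cocycle A ω n) x‖ := by gcongr; exact ih.2
      _ ≤ _ := hE.expands _ _ ih.1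

theorem IsContractionCone.exists_preimage {A : Fin 2 → IntMat} {C : Set Plane} {lamC : ℝ}
    (hC : IsContractionCone A C lamC) (hdet : ∀ i, (A i).det = 1) (ω : Env) (n : ℕ) {w : Plane}
    (hw : w ∈ C) :
    ∃ x, planeMap (cocycle A ω n) x = w ∧ lamC⁻¹ ^ n * ‖w‖ ≤ ‖x‖ := by
  induction n generalizing w with
  | zero => exact ⟨w, by simp [cocycle, planeMap_one_apply]⟩
  | succ n ih =>
    obtain ⟨x, hx, hx'⟩ := ih (hC.invariant (ω n) hw)
    refine ⟨x, ?_, ?_⟩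
    · rw [cocycle, planeMap_mul_apply, hx, ← planeMap_mul_apply,
        Matrix.mul_nonsing_inv _ (by rw [hdet]; exact isUnit_one), planeMap_one_apply]
    · have h0 : 0 ≤ lamC⁻¹ := (inv_pos.2 hC.pos).le
      calc lamC⁻¹ ^ (n + 1) * ‖w‖ = lamC⁻¹ ^ n * (lamC⁻¹ * ‖w‖) := by ring
        _ ≤ lamC⁻¹ ^ n * ‖planeMap (A (ω n))⁻¹ w‖ := by gcongr; exact hC.contracts _ _ hw
        _ ≤ _ := hx'

theorem IsPositiveModel.wordProduct_nonneg {A : Fin 2 → IntMat}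
    {Q : Fin 2 → Matrix (Fin 2) (Fin 2) ℝ} {e : (Fin 2 → ℝ) ≃ₗ[ℝ] Plane}
    (h : IsPositiveModel A Q e) (ω : Env) (n : ℕ) (i j : Fin 2) :
    0 ≤ wordProduct Q ω n i j := by
  obtain ⟨κ, hκ, hκr⟩ := exists_entry_ratio_bound h.pos
  exact (balanced_wordProduct h.pos hκ hκr ω n).nonneg i j

/-- The norms of the products grow at least at the larger of the rates of the two cones: expansion
on `E` bounds `A_ω^n` from below, expansion on `C` its inverse, which has the same norm. -/
theorem HasConeProperty.exists_pow_le_entrySum {A : Fin 2 → IntMat} {E C : Set Plane}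
    {lamE lamC : ℝ} (hA : HasConeProperty A E C lamE lamC)
    {Q : Fin 2 → Matrix (Fin 2) (Fin 2) ℝ} {e : (Fin 2 → ℝ) ≃ₗ[ℝ] Plane}
    (h : IsPositiveModel A Q e) :
    ∃ c : ℝ, 0 < c ∧ ∀ (ω : Env) (n : ℕ),
      c * max lamC⁻¹ lamE ^ n ≤ entrySum (wordProduct Q ω n) := by
  have hdet : ∀ i, (A i).det = 1 := fun i => (hA.hyperbolic i).1
  obtain ⟨K, hK, hKe⟩ := exists_l1_bounds e
  have hbound : ∀ lam : ℝ, (∃ w : Plane, w ≠ 0 ∧ ∀ (ω : Env) (n : ℕ),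
      lam ^ n * ‖w‖ ≤ K ^ 2 * entrySum (wordProduct Q ω n) * ‖w‖) →
      ∀ (ω : Env) (n : ℕ), (K ^ 2)⁻¹ * lam ^ n ≤ entrySum (wordProduct Q ω n) := by
    rintro lam ⟨w, hw, hle⟩ ω n
    rw [inv_mul_le_iff₀ (by positivity)]
    exact le_of_mul_le_mul_right (hle ω n) (norm_pos_iff.2 hw)
  refine ⟨(K ^ 2)⁻¹, by positivity, ?_⟩
  rcases max_choice lamC⁻¹ lamE with hm | hm <;> rw [hm] <;> apply hbound
  · obtain ⟨w, hwC, hw⟩ := exists_mem_ne_zero_of_isCone hA.contraction.isCone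
    refine ⟨w, hw, fun ω n => ?_⟩
    obtain ⟨x, hx, hxw⟩ := hA.contraction.exists_preimage hdet ω n hwC
    refine hxw.trans ?_
    set x' := e.symm x
    have hex : e x' = x := e.apply_symm_apply x
    have h1 := l1_le_entrySum_mul (h.wordProduct_nonneg ω n) (det_wordProduct h.det ω n) x'
    have h2 := (hKe ((wordProduct Q ω n).mulVec x')).2
    rw [← h.norm_planeMap, hex, hx] at h2
    have hN := entrySum_nonneg (h.wordProduct_nonneg ω n)
    calc ‖x‖ ≤ K * l1 x' := by rw [← hex]; exact (hKe x').1
      _ ≤ K * (entrySum (wordProduct Q ω n) * (K * ‖w‖)) := by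
        gcongr
        exact h1.trans (by gcongr)
      _ = _ := by ring
  · obtain ⟨w, hwE, hw⟩ := exists_mem_ne_zero_of_isCone hA.expansion.isCone
    refine ⟨w, hw, fun ω n => (hA.expansion.mem_and_pow_le ω n hwE).2.trans ?_⟩
    set w' := e.symm w
    have hew : e w' = w := e.apply_symm_apply w
    have hN := entrySum_nonneg (h.wordProduct_nonneg ω n)
    have h1 := l1_mulVec_le (h.wordProduct_nonneg ω n) w'
    have h2 := (hKe w').2
    rw [hew] at h2
    rw [← hew, h.norm_planeMap, hew]
    calc _ ≤ K * l1 ((wordProduct Q ω n).mulVec w') := (hKe _).1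
      _ ≤ K * (entrySum (wordProduct Q ω n) * (K * ‖w‖)) := by
        gcongr
        exact h1.trans (by gcongr)
      _ = _ := by ring

/-! ### Fourier series on the torus and correlations -/

instance isProbabilityMeasure_torusMeasure : IsProbabilityMeasure torusMeasure := by
  unfold torusMeasure; infer_instance

instance isAddHaarMeasure_torusMeasure : torusMeasure.IsAddHaarMeasure := by
  unfold torusMeasure; infer_instance

/-- The character `x ↦ e^{i q·x}` of the torus. -/
def torusChar (q : Fin 2 → ℤ) : C(Torus, ℂ) where
  toFun x := ∏ i, fourier (q i) (x i)
  continuous_toFun := by fun_prop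

/-- The Fourier coefficient `∫ e^{-i q·x} F(x) dm(x)` of a function on the torus. -/
def torusCoef (F : Torus → ℂ) (q : Fin 2 → ℤ) : ℂ := ∫ x, torusChar (-q) x * F x ∂torusMeasure

theorem torusChar_apply (q : Fin 2 → ℤ) (x : Torus) :
    torusChar q x = fourier (q 0) (x 0) * fourier (q 1) (x 1) := by
  simp [torusChar, Fin.prod_univ_two]

theorem torusChar_zero (x : Torus) : torusChar 0 x = 1 := by simp [torusChar_apply]

theorem torusChar_add (p q : Fin 2 → ℤ) (x : Torus) :
    torusChar (p + q) x = torusChar p x * torusChar q x := by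
  simp only [torusChar_apply, Pi.add_apply, fourier_add]
  ring

theorem norm_torusChar_apply (q : Fin 2 → ℤ) (x : Torus) : ‖torusChar q x‖ = 1 := by
  rw [torusChar_apply, norm_mul, fourier_apply, fourier_apply]
  exact (congrArg₂ (· * ·) (Circle.norm_coe _) (Circle.norm_coe _)).trans (one_mul 1)

theorem torusCoef_zero (F : Torus → ℂ) : torusCoef F 0 = ∫ x, F x ∂torusMeasure := by
  simp [torusCoef, torusChar_zero]

theorem integrable_torusChar_mul {F : Torus → ℂ} (hF : Integrable F torusMeasure)
    (q : Fin 2 → ℤ) : Integrable (fun x => torusChar q x * F x) torusMeasure :=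
  hF.bdd_mul (torusChar q).continuous.aestronglyMeasurable
    (Eventually.of_forall fun x => (norm_torusChar_apply q x).le)

theorem integral_torusChar (q : Fin 2 → ℤ) :
    ∫ x, torusChar q x ∂torusMeasure = if q = 0 then 1 else 0 := by
  have h1 : ∀ n : ℤ, ∫ t : AddCircle (2 * Real.pi), (fourier n t : ℂ) ∂AddCircle.haarAddCircle =
      if n = 0 then 1 else 0 := fun n => by
    have := congrFun (fourierCoeff_fourier (T := 2 * Real.pi) n) 0
    simpa [fourierCoeff, Pi.single_apply, eq_comm] using this
  have h2 := integral_fintype_prod_eq_prod (𝕜 := ℂ)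
    (fun (i : Fin 2) (t : AddCircle (2 * Real.pi)) => (fourier (q i) t : ℂ))
    (μ := fun _ => AddCircle.haarAddCircle)
  rw [torusMeasure]
  refine h2.trans ?_
  rw [Fin.prod_univ_two, h1, h1]
  by_cases h : q = 0
  · simp [h]
  · have : ¬ (q 0 = 0 ∧ q 1 = 0) := fun h' => h (by ext i; fin_cases i; exacts [h'.1, h'.2])
    rw [if_neg h]
    by_cases h0 : q 0 = 0
    · have h1 : q 1 ≠ 0 := fun h1 => this ⟨h0, h1⟩
      simp [h1]
    · simp [h0]

/-- The star subalgebra of trigonometric polynomials, generated by the characters. -/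
def torusCharSubalgebra : StarSubalgebra ℂ C(Torus, ℂ) where
  toSubalgebra := Algebra.adjoin ℂ (Set.range torusChar)
  star_mem' := by
    change Algebra.adjoin ℂ (Set.range torusChar) ≤
      star (Algebra.adjoin ℂ (Set.range torusChar))
    refine Algebra.adjoin_le ?_
    rintro _ ⟨q, rfl⟩
    refine Algebra.subset_adjoin ⟨-q, ?_⟩
    ext1 x
    simp [torusChar_apply]

theorem torusCharSubalgebra_coe :
    torusCharSubalgebra.toSubalgebra.toSubmodule = Submodule.span ℂ (Set.range torusChar) := by
  apply Algebra.adjoin_eq_span_of_subset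
  refine .trans (fun x => Submonoid.closure_induction (fun _ => id) ⟨0, ?_⟩ ?_)
    Submodule.subset_span
  · ext x
    exact torusChar_zero x
  · rintro _ _ _ _ ⟨p, rfl⟩ ⟨q, rfl⟩
    exact ⟨p + q, by ext x; exact torusChar_add p q x⟩

theorem torusCharSubalgebra_separatesPoints : torusCharSubalgebra.SeparatesPoints := by
  intro x y hxy
  obtain ⟨i, hi⟩ := Function.ne_iff.1 hxy
  have hT : (2 * Real.pi) ≠ 0 := Real.two_pi_pos.ne'
  have hinj : ∀ s t : AddCircle (2 * Real.pi), (fourier 1 s : ℂ) = fourier 1 t → s = t := by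
    intro s t h
    rw [fourier_one, fourier_one, Circle.coe_inj] at h
    exact AddCircle.injective_toCircle hT h
  refine ⟨_, ⟨torusChar (Pi.single i 1), Algebra.subset_adjoin ⟨_, rfl⟩, rfl⟩, fun h => hi ?_⟩
  apply hinj
  fin_cases i <;> simpa [torusChar_apply] using h

theorem span_torusChar_closure_eq_top :
    (Submodule.span ℂ (Set.range torusChar)).topologicalClosure = ⊤ := by
  rw [← torusCharSubalgebra_coe]
  exact congr_arg (Subalgebra.toSubmodule <| StarSubalgebra.toSubalgebra ·)
    (ContinuousMap.starSubalgebra_topologicalClosure_eq_top_of_separatesPoints _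
      torusCharSubalgebra_separatesPoints)

theorem integral_mul_eq_zero_of_torusCoef {F : Torus → ℂ} (hF : Integrable F torusMeasure)
    (h : ∀ q, torusCoef F q = 0) (φ : C(Torus, ℂ)) : ∫ x, φ x * F x ∂torusMeasure = 0 := by
  have hint : ∀ φ : C(Torus, ℂ), Integrable (fun x => φ x * F x) torusMeasure := fun φ =>
    hF.bdd_mul φ.continuous.aestronglyMeasurable (Eventually.of_forall φ.norm_coe_le_norm)
  let L₀ : C(Torus, ℂ) →ₗ[ℂ] ℂ :=
    { toFun := fun φ => ∫ x, φ x * F x ∂torusMeasure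
      map_add' := fun φ ψ => by
        simp only [ContinuousMap.add_apply, add_mul]
        exact integral_add (hint φ) (hint ψ)
      map_smul' := fun a φ => by
        simp only [ContinuousMap.smul_apply, smul_eq_mul, mul_assoc, RingHom.id_apply]
        exact integral_const_mul a _ }
  let L : C(Torus, ℂ) →L[ℂ] ℂ := L₀.mkContinuous (∫ x, ‖F x‖ ∂torusMeasure) fun φ => by
    calc ‖∫ x, φ x * F x ∂torusMeasure‖ ≤ ∫ x, ‖φ‖ * ‖F x‖ ∂torusMeasure :=
          norm_integral_le_of_norm_le (hF.norm.const_mul _) (Eventually.of_forall fun x => by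
            rw [norm_mul]
            gcongr
            exact φ.norm_coe_le_norm x)
      _ = _ := by rw [integral_const_mul, mul_comm]
  have hker : Submodule.span ℂ (Set.range torusChar) ≤ LinearMap.ker (L : C(Torus, ℂ) →ₗ[ℂ] ℂ) := by
    rw [Submodule.span_le]
    rintro _ ⟨q, rfl⟩
    have := h (-q)
    rw [torusCoef, neg_neg] at this
    exact this
  have hcl := Submodule.topologicalClosure_minimal _ hker L.isClosed_ker
  rw [span_torusChar_closure_eq_top] at hcl
  exact hcl (Submodule.mem_top (x := φ))

/-- Uniqueness of Fourier coefficients for integrable functions on the torus: a function orthogonal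
to all characters is orthogonal to continuous functions, by the Stone–Weierstrass theorem, and hence
to the indicators of closed sets. -/
theorem ae_eq_zero_of_torusCoef {F : Torus → ℂ} (hF : Integrable F torusMeasure)
    (h : ∀ q, torusCoef F q = 0) : F =ᵐ[torusMeasure] 0 := by
  refine ae_eq_zero_of_forall_setIntegral_isClosed_eq_zero hF fun s hs => ?_
  let φ : ℕ → C(Torus, ℂ) := fun n =>
    ⟨fun x => ((hs.apprSeq n x : ℝ) : ℂ), by fun_prop⟩
  have hlim : Tendsto (fun n => ∫ x, φ n x * F x ∂torusMeasure) atTop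
      (𝓝 (∫ x, s.indicator F x ∂torusMeasure)) := by
    refine tendsto_integral_of_dominated_convergence (fun x => ‖F x‖)
      (fun n => (φ n).continuous.aestronglyMeasurable.mul hF.aestronglyMeasurable) hF.norm
      (fun n => Eventually.of_forall fun x => ?_) (Eventually.of_forall fun x => ?_)
    · have h1 : (hs.apprSeq n x : ℝ) ≤ 1 := by
        exact_mod_cast HasOuterApproxClosed.apprSeq_apply_le_one hs n x
      rw [norm_mul]
      refine mul_le_of_le_one_left (norm_nonneg _) ?_
      simpa [φ] using h1
    · have h2 := tendsto_pi_nhds.1 (HasOuterApproxClosed.tendsto_apprSeq hs) x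
      have h3 : Tendsto (fun n => φ n x) atTop
          (𝓝 (((s.indicator (fun _ => (1 : NNReal)) x : NNReal) : ℝ) : ℂ)) :=
        (Complex.continuous_ofReal.tendsto _).comp ((NNReal.continuous_coe.tendsto _).comp h2)
      convert h3.mul_const (F x) using 2
      by_cases hx : x ∈ s <;> simp [hx]
  simp_rw [integral_mul_eq_zero_of_torusCoef hF h] at hlim
  rw [← integral_indicator hs.measurableSet]
  exact (tendsto_nhds_unique hlim tendsto_const_nhds)

/-- An integrable function with summable Fourier coefficients is almost everywhere the sum of its
Fourier series, because both have the same coefficients. -/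
theorem ae_eq_tsum_torusCoef {F : Torus → ℂ} (hF : Integrable F torusMeasure)
    (hs : Summable fun q => ‖torusCoef F q‖) :
    F =ᵐ[torusMeasure] fun x => ∑' q, torusCoef F q * torusChar q x := by
  have hcont : Continuous fun x => ∑' q, torusCoef F q * torusChar q x :=
    continuous_tsum (fun q => continuous_const.mul (torusChar q).continuous) hs fun q x => by
      rw [norm_mul, norm_torusChar_apply, mul_one]
  have hSint : Integrable (fun x => ∑' q, torusCoef F q * torusChar q x) torusMeasure :=
    Integrable.of_bound hcont.aestronglyMeasurable (∑' q, ‖torusCoef F q‖)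
      (Eventually.of_forall fun x => tsum_of_norm_bounded hs.hasSum fun q => by
        rw [norm_mul, norm_torusChar_apply, mul_one])
  have hcoef : ∀ q, torusCoef (fun x => ∑' q, torusCoef F q * torusChar q x) q =
      torusCoef F q := fun q => by
    have h1 : ∀ r, Integrable (fun x => torusCoef F r * torusChar (-q + r) x) torusMeasure :=
      fun r => by
        have := (integrable_torusChar_mul (integrable_const (torusCoef F r)) (-q + r))
        simpa only [mul_comm] using this
    have h2 := hasSum_integral_of_summable_integral_norm h1 (by
      simpa [norm_torusChar_apply] using hs)
    have h3 : ∀ r, ∫ x, torusCoef F r * torusChar (-q + r) x ∂torusMeasure =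
        if r = q then torusCoef F q else 0 := fun r => by
      rw [integral_const_mul, integral_torusChar]
      by_cases h : r = q
      · simp [h]
      · have : -q + r ≠ 0 := fun h' => h (neg_add_eq_zero.1 h').symm
        simp [h, this]
    simp_rw [h3] at h2
    rw [torusCoef]
    refine Eq.trans ?_ (h2.unique (hasSum_ite_eq q (torusCoef F q)))
    refine integral_congr_ae (Eventually.of_forall fun x => ?_)
    simp only
    rw [← tsum_mul_left]
    refine tsum_congr fun r => ?_
    rw [torusChar_add]
    ring
  have := ae_eq_zero_of_torusCoef (hF.sub hSint) fun q => by
    have : torusCoef (F - fun x => ∑' q, torusCoef F q * torusChar q x) q =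
        torusCoef F q - torusCoef (fun x => ∑' q, torusCoef F q * torusChar q x) q := by
      simp only [torusCoef, Pi.sub_apply, mul_sub]
      exact integral_sub (integrable_torusChar_mul hF _) (integrable_torusChar_mul hSint _)
    rw [this, hcoef, sub_self]
  filter_upwards [this] with x hx
  exact sub_eq_zero.1 hx

theorem torusMap_mul (M N : IntMat) (x : Torus) :
    torusMap (M * N) x = torusMap M (torusMap N x) := by
  ext i
  simp only [torusMap, Matrix.mul_apply, Fin.sum_univ_two, smul_add, add_smul, mul_smul]
  abel

theorem torusMap_one (x : Torus) : torusMap 1 x = x := by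
  ext i
  simp [torusMap, Matrix.one_apply]

theorem measurePreserving_torusMap {M : IntMat} (hM : M.det = 1) :
    MeasurePreserving (torusMap M) torusMeasure torusMeasure := by
  let φ : Torus →+ Torus :=
    { toFun := torusMap M
      map_zero' := by ext i; simp [torusMap]
      map_add' := fun x y => by
        ext i
        simp [torusMap, Finset.sum_add_distrib] }
  have hcont : Continuous φ := by
    change Continuous (torusMap M)
    unfold torusMap
    fun_prop
  have hsurj : Function.Surjective φ := fun x => ⟨torusMap M⁻¹ x, by
    change torusMap M (torusMap M⁻¹ x) = x
    rw [← torusMap_mul, Matrix.mul_nonsing_inv _ (by rw [hM]; exact isUnit_one), torusMap_one]⟩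
  exact φ.measurePreserving hcont hsurj rfl

theorem torusChar_torusMap (M : IntMat) (q : Fin 2 → ℤ) (x : Torus) :
    torusChar q (torusMap M x) = torusChar (M.transpose.mulVec q) x := by
  have hadd : ∀ (n : ℤ) (s t : AddCircle (2 * Real.pi)),
      (fourier n (s + t) : ℂ) = fourier n s * fourier n t := fun n s t => by
    simp [fourier_apply, smul_add, AddCircle.toCircle_add]
  have hsmul : ∀ (n k : ℤ) (s : AddCircle (2 * Real.pi)),
      (fourier n (k • s) : ℂ) = fourier (k * n) s := fun n k s => by
    have : n • k • s = (k * n) • s := by rw [← mul_smul, mul_comm n k]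
    simp only [fourier_apply, this]
  simp only [torusChar_apply, torusMap, Fin.sum_univ_two, hadd, hsmul, Matrix.mulVec, dotProduct,
    Matrix.transpose_apply, fourier_add]
  ring

/-- The Parseval formula for the correlation of `F ∘ M` and `G`, where only `F` needs to have a
summable Fourier series. -/
theorem hasSum_torusCoef_mul {F G : Torus → ℂ} (hF : Integrable F torusMeasure)
    (hG : Integrable G torusMeasure) (hs : Summable fun q => ‖torusCoef F q‖) {M : IntMat}
    (hM : M.det = 1) :
    HasSum (fun q => torusCoef F q * torusCoef G (-(M.transpose.mulVec q)))
      (∫ x, F (torusMap M x) * G x ∂torusMeasure) := by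
  have h1 : ∀ q, Integrable
      (fun x => torusCoef F q * (torusChar (M.transpose.mulVec q) x * G x)) torusMeasure :=
    fun q => (integrable_torusChar_mul hG _).const_mul _
  have h2 := hasSum_integral_of_summable_integral_norm h1 (by
    simp only [norm_mul, norm_torusChar_apply, one_mul, integral_const_mul]
    exact hs.mul_right _)
  have h3 : ∀ q, ∫ x, torusCoef F q * (torusChar (M.transpose.mulVec q) x * G x) ∂torusMeasure =
      torusCoef F q * torusCoef G (-(M.transpose.mulVec q)) := fun q => by
    rw [integral_const_mul, torusCoef, torusCoef, neg_neg]
  have h4 : ∫ x, F (torusMap M x) * G x ∂torusMeasure =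
      ∫ x, ∑' q, torusCoef F q * (torusChar (M.transpose.mulVec q) x * G x) ∂torusMeasure := by
    refine integral_congr_ae ?_
    filter_upwards [(measurePreserving_torusMap hM).quasiMeasurePreserving.ae
      (ae_eq_tsum_torusCoef hF hs)] with x hx
    rw [hx, ← tsum_mul_right]
    refine tsum_congr fun q => ?_
    rw [torusChar_torusMap, mul_assoc]
  rw [h4]
  simpa only [h3] using h2

theorem intNorm_neg (q : Fin 2 → ℤ) : intNorm (-q) = intNorm q := by
  simp [intNorm, EuclideanSpace.norm_eq, Fin.sum_univ_two]

theorem intNorm_zero_rpow {β : ℝ} (hβ : 0 < β) : intNorm 0 ^ β = 0 := by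
  have : intNorm 0 = 0 := by simp [intNorm, EuclideanSpace.norm_eq]
  rw [this, Real.zero_rpow hβ.ne']

/-- Decay of correlations from separation of frequencies: if the dual action of `M` never maps a
low frequency to a low frequency, the correlation of `F ∘ M` and `G` is small. -/
theorem norm_correlation_le {F G : Torus → ℂ} (hF : Integrable F torusMeasure)
    (hG : Integrable G torusMeasure) {β a b R : ℝ} (hβ : 0 < β)
    (hs : Summable fun q => ‖torusCoef F q‖ * intNorm q ^ β)
    (ha : ∑' q, ‖torusCoef F q‖ * intNorm q ^ β ≤ a)
    (hb : ∀ q, ‖torusCoef G q‖ * intNorm q ^ β ≤ b) {M : IntMat} (hM : M.det = 1) (hR : 0 < R)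
    (hq : ∀ q : Fin 2 → ℤ, q ≠ 0 → R ≤ intNorm q * intNorm (M.transpose.mulVec q)) :
    ‖(∫ x, F (torusMap M x) * G x ∂torusMeasure) -
      (∫ x, F x ∂torusMeasure) * (∫ x, G x ∂torusMeasure)‖ ≤ a * b * R ^ (-β) := by
  have hb0 : 0 ≤ b := by simpa [intNorm_zero_rpow hβ] using hb 0
  have hsF : Summable fun q => ‖torusCoef F q‖ := by
    refine Summable.of_norm_bounded_eventually hs ?_
    refine (Set.finite_singleton (0 : Fin 2 → ℤ)).subset fun q hq' => ?_
    by_contra h0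
    refine hq' ?_
    simp only [Set.mem_ofPred_eq, norm_norm]
    exact le_mul_of_one_le_right (norm_nonneg _)
      (Real.one_le_rpow (one_le_intNorm h0) hβ.le)
  have hsum := (hasSum_torusCoef_mul hF hG hsF hM).update 0 0
  have hmul : ∀ q : Fin 2 → ℤ, ‖Function.update
      (fun q => torusCoef F q * torusCoef G (-(M.transpose.mulVec q))) 0 0 q‖ ≤
      ‖torusCoef F q‖ * intNorm q ^ β * (b * R ^ (-β)) := by
    intro q
    by_cases h0 : q = 0
    · subst h0
      simp [intNorm_zero_rpow hβ]
    rw [Function.update_of_ne h0, norm_mul]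
    set w := M.transpose.mulVec q with hw
    have h1 := hb (-w)
    rw [intNorm_neg] at h1
    have hqn := one_le_intNorm h0
    have hwn : 1 ≤ intNorm w :=
      one_le_intNorm (mulVec_ne_zero_of_det (by rwa [Matrix.det_transpose]) h0)
    have hRp : R ^ β ≤ intNorm q ^ β * intNorm w ^ β := by
      rw [← Real.mul_rpow (by linarith) (by linarith)]
      exact Real.rpow_le_rpow hR.le (hq q h0) hβ.le
    have hRβ : 0 < R ^ β := Real.rpow_pos_of_pos hR β
    have hqβ : 0 < intNorm q ^ β := Real.rpow_pos_of_pos (by linarith) β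
    rw [Real.rpow_neg hR.le, ← mul_assoc, ← div_eq_mul_inv, le_div_iff₀ hRβ]
    calc ‖torusCoef F q‖ * ‖torusCoef G (-w)‖ * R ^ β
        ≤ ‖torusCoef F q‖ * ‖torusCoef G (-w)‖ * (intNorm q ^ β * intNorm w ^ β) := by gcongr
      _ = ‖torusCoef F q‖ * intNorm q ^ β * (‖torusCoef G (-w)‖ * intNorm w ^ β) := by ring
      _ ≤ _ := by gcongr
  have hval : 0 - torusCoef F 0 * torusCoef G (-(M.transpose.mulVec 0)) +
      (∫ x, F (torusMap M x) * G x ∂torusMeasure) =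
      (∫ x, F (torusMap M x) * G x ∂torusMeasure) -
        (∫ x, F x ∂torusMeasure) * (∫ x, G x ∂torusMeasure) := by
    rw [Matrix.mulVec_zero, neg_zero, torusCoef_zero, torusCoef_zero]
    ring
  rw [hval] at hsum
  have := (hs.mul_right (b * R ^ (-β))).hasSum
  rw [← hsum.tsum_eq]
  refine (tsum_of_norm_bounded this hmul).trans ?_
  rw [tsum_mul_right, mul_assoc]
  have : 0 ≤ R ^ (-β) := Real.rpow_nonneg hR.le _
  gcongr

theorem StrongHolder.summable_and_tsum_le {β : ℝ} {f : Env × Torus → ℂ} (hf : StrongHolder β f)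
    (ω : Env) :
    (Summable fun q => ‖torusCoef (fun x => f (ω, x)) q‖ * intNorm q ^ β) ∧
      ∑' q, ‖torusCoef (fun x => f (ω, x)) q‖ * intNorm q ^ β ≤ holderNorm β f := by
  have hnn : ∀ q : Fin 2 → ℤ, 0 ≤ ‖torusCoef (fun x => f (ω, x)) q‖ * intNorm q ^ β :=
    fun q => mul_nonneg (norm_nonneg _) (Real.rpow_nonneg (intNorm_nonneg q) _)
  have heq : ∀ q : Fin 2 → ℤ, ‖fourierCoef f ω q‖ₑ * ENNReal.ofReal (intNorm q ^ β) =
      ENNReal.ofReal (‖torusCoef (fun x => f (ω, x)) q‖ * intNorm q ^ β) := fun q => by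
    rw [ENNReal.ofReal_mul (norm_nonneg _), ofReal_norm]
    rfl
  have hle : ∑' q : Fin 2 → ℤ,
      ENNReal.ofReal (‖torusCoef (fun x => f (ω, x)) q‖ * intNorm q ^ β) ≤ holderENorm β f := by
    simp_rw [← heq]
    exact le_iSup (fun ω => ∑' q : Fin 2 → ℤ,
      ‖fourierCoef f ω q‖ₑ * ENNReal.ofReal (intNorm q ^ β)) ω
  have hs : Summable fun q => ‖torusCoef (fun x => f (ω, x)) q‖ * intNorm q ^ β := by
    have := ENNReal.summable_toReal (hle.trans_lt hf.finite).ne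
    simpa only [ENNReal.toReal_ofReal (hnn _)] using this
  refine ⟨hs, ?_⟩
  rw [← ENNReal.ofReal_tsum_of_nonneg hnn hs] at hle
  exact (ENNReal.ofReal_le_iff_le_toReal hf.finite.ne).1 hle

theorem skew_iterate (A : Fin 2 → IntMat) (ω : Env) (x : Torus) (n : ℕ) :
    (skew A)^[n] (ω, x) = (shift^[n] ω, torusMap (cocycle A ω n) x) := by
  induction n with
  | zero => simp [cocycle, torusMap_one]
  | succ n ih =>
    have h0 : (shift^[n] ω) 0 = ω n := by rw [shift_iterate_apply, zero_add]
    simp only [Function.iterate_succ_apply', ih, skew, cocycle, torusMap_mul, h0]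

/-- Both correlations are controlled by the separation of the frequencies under `A_ω^n`. -/
theorem norm_corr_le {A : Fin 2 → IntMat} (hdet : ∀ i, (A i).det = 1) {β : ℝ} (hβ : 0 < β)
    {f g : Env × Torus → ℂ} (hf : StrongHolder β f) (hg : StrongHolder β g) (ω : Env) (n : ℕ)
    {R : ℝ} (hR : 0 < R) (hq : ∀ q : Fin 2 → ℤ, q ≠ 0 →
      R ≤ intNorm q * intNorm ((cocycle A ω n).transpose.mulVec q)) :
    ‖corr A f g ω n‖ ≤ holderNorm β f * holderNorm β g * R ^ (-β) ∧
      ‖corrSkew A f g ω n‖ ≤ holderNorm β f * holderNorm β g * R ^ (-β) := by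
  have hgb : ∀ q, ‖torusCoef (fun x => g (ω, x)) q‖ * intNorm q ^ β ≤ holderNorm β g := fun q =>
    ((hg.summable_and_tsum_le ω).1.le_tsum q fun r _ =>
      mul_nonneg (norm_nonneg _) (Real.rpow_nonneg (intNorm_nonneg r) _)).trans
      (hg.summable_and_tsum_le ω).2
  have key : ∀ ω', ‖(∫ x, f (ω', torusMap (cocycle A ω n) x) * g (ω, x) ∂torusMeasure) -
      (∫ x, f (ω', x) ∂torusMeasure) * (∫ x, g (ω, x) ∂torusMeasure)‖ ≤
      holderNorm β f * holderNorm β g * R ^ (-β) := fun ω' =>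
    norm_correlation_le (hf.integrable ω') (hg.integrable ω) hβ (hf.summable_and_tsum_le ω').1
      (hf.summable_and_tsum_le ω').2 hgb (det_cocycle hdet ω n) hR hq
  refine ⟨key ω, ?_⟩
  rw [corrSkew]
  simp_rw [skew_iterate]
  exact key _

/-! ### Almost additive processes over the Bernoulli shift -/

theorem measurePreserving_shift_iterate {p : ℝ} (hp : p ∈ Set.Ioo (0 : ℝ) 1) (m : ℕ) :
    MeasurePreserving shift^[m] (envMeasure p) (envMeasure p) := by
  have := isProbabilityMeasure_coin hp
  have heq : shift^[m] = fun (ω : Env) k => ω (k + m) := by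
    funext ω k
    exact shift_iterate_apply m ω k
  rw [heq]
  exact ⟨by fun_prop, Measure.map_infinitePi_infinitePi_of_inj (add_left_injective m)⟩

/-- A function of the environment that only depends on the coordinates in `[a, a + m)` factors
through the restriction to these coordinates. -/
theorem exists_factor_restrict {h : Env → ℝ} {m : ℕ}
    (hdep : ∀ ω ω' : Env, (∀ k < m, ω k = ω' k) → h ω = h ω') (a : ℕ) :
    ∃ φ : ((Finset.Ico a (a + m)) → Fin 2) → ℝ,
      (fun ω => h (shift^[a] ω)) = φ ∘ fun (ω : Env) (k : Finset.Ico a (a + m)) => ω k := by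
  refine ⟨fun y => h fun k => if hk : k + a ∈ Finset.Ico a (a + m) then y ⟨k + a, hk⟩ else 0, ?_⟩
  funext ω
  refine hdep _ _ fun k hk => ?_
  have : k + a ∈ Finset.Ico a (a + m) := Finset.mem_Ico.2 ⟨by omega, by omega⟩
  simp only [dif_pos this, shift_iterate_apply]

theorem measurable_of_dependsOn_initial {h : Env → ℝ} {m : ℕ}
    (hdep : ∀ ω ω' : Env, (∀ k < m, ω k = ω' k) → h ω = h ω') : Measurable h := by
  obtain ⟨φ, hφ⟩ := exists_factor_restrict hdep 0
  simp only [Function.iterate_zero, id_eq] at hφ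
  change Measurable (fun ω => h ω)
  rw [hφ]
  exact (measurable_of_finite φ).comp (by fun_prop)

theorem exists_bound_of_dependsOn_initial {h : Env → ℝ} {m : ℕ}
    (hdep : ∀ ω ω' : Env, (∀ k < m, ω k = ω' k) → h ω = h ω') : ∃ B, ∀ ω, |h ω| ≤ B := by
  obtain ⟨φ, hφ⟩ := exists_factor_restrict hdep 0
  obtain ⟨B, hB⟩ := Finite.exists_le fun y => |φ y|
  exact ⟨B, fun ω => by
    have := congrFun hφ ω
    simp only [Function.iterate_zero, id_eq] at this
    rw [this]
    exact hB _⟩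

/-- The strong law of large numbers for a function of `m` coordinates, evaluated on the successive
blocks of length `m`. -/
theorem ae_tendsto_block_average {p : ℝ} (hp : p ∈ Set.Ioo (0 : ℝ) 1) {h : Env → ℝ} {m : ℕ}
    (hdep : ∀ ω ω' : Env, (∀ k < m, ω k = ω' k) → h ω = h ω') :
    ∀ᵐ ω ∂(envMeasure p), Tendsto
      (fun n : ℕ => (∑ j ∈ Finset.range n, h (shift^[j * m] ω)) / n) atTop
      (𝓝 (∫ ω, h ω ∂(envMeasure p))) := by
  have hcoin := isProbabilityMeasure_coin hp
  have hprob : IsProbabilityMeasure (envMeasure p) := by unfold envMeasure; infer_instance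
  have hmeas := measurable_of_dependsOn_initial hdep
  have hindep : ProbabilityTheory.iIndepFun (fun (k : ℕ) (ω : Env) => ω k) (envMeasure p) :=
    ProbabilityTheory.iIndepFun_infinitePi (X := fun _ s => s) (fun _ => measurable_id)
  have h := ProbabilityTheory.strong_law_ae_real (μ := envMeasure p)
    (fun j ω => h (shift^[j * m] ω)) ?_ ?_ ?_
  · simpa using h
  · obtain ⟨B, hB⟩ := exists_bound_of_dependsOn_initial hdep
    simp only [zero_mul, Function.iterate_zero, id_eq]
    exact Integrable.of_bound hmeas.aestronglyMeasurable B (Eventually.of_forall hB)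
  · intro i j hij
    obtain ⟨φ, hφ⟩ := exists_factor_restrict hdep (i * m)
    obtain ⟨ψ, hψ⟩ := exists_factor_restrict hdep (j * m)
    change ProbabilityTheory.IndepFun (fun ω => h (shift^[i * m] ω))
      (fun ω => h (shift^[j * m] ω)) (envMeasure p)
    rw [hφ, hψ]
    have hdisj : Disjoint (Finset.Ico (i * m) (i * m + m)) (Finset.Ico (j * m) (j * m + m)) := by
      rw [Finset.disjoint_left]
      intro k hk hk'
      rw [Finset.mem_Ico] at hk hk'
      rcases lt_or_gt_of_ne hij with hlt | hlt
      · have := Nat.mul_le_mul_right m hlt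
        rw [Nat.succ_mul] at this
        omega
      · have := Nat.mul_le_mul_right m hlt
        rw [Nat.succ_mul] at this
        omega
    exact (hindep.indepFun_finset _ _ hdisj fun k => measurable_pi_apply k).comp
      (measurable_of_finite φ) (measurable_of_finite ψ)
  · intro j
    have hpres := measurePreserving_shift_iterate hp (j * m)
    refine ⟨(hmeas.comp hpres.measurable).aemeasurable,
      by simpa using hmeas.aemeasurable, ?_⟩
    simp only [zero_mul, Function.iterate_zero, id_eq]
    change Measure.map (h ∘ shift^[j * m]) (envMeasure p) = Measure.map h (envMeasure p)
    rw [← Measure.map_map hmeas hpres.measurable, hpres.map_eq]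

theorem abs_sub_sum_blocks_le {g : ℕ → Env → ℝ} {D : ℝ}
    (hadd : ∀ m n ω, |g (m + n) ω - g m ω - g n (shift^[m] ω)| ≤ D) (m k : ℕ) (ω : Env) :
    |g (k * m) ω - ∑ j ∈ Finset.range k, g m (shift^[j * m] ω)| ≤ (k + 1) * D := by
  induction k with
  | zero =>
    have := hadd 0 0 ω
    simp only [add_zero, Function.iterate_zero, id_eq, sub_self, zero_sub, abs_neg] at this
    simpa using this
  | succ k ih =>
    have := hadd (k * m) m ω
    rw [Finset.sum_range_succ, Nat.succ_mul]
    push_cast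
    rw [abs_le] at this ih ⊢
    constructor <;> linarith [this.1, this.2, ih.1, ih.2]

/-- An ergodic theorem for processes over the Bernoulli shift that are additive up to a bounded
error: by the law of large numbers for blocks of length `m`, the averages are eventually within
`O(1 / m)` of a constant, for every `m`. -/
theorem exists_ae_tendsto_of_almost_additive {p : ℝ} (hp : p ∈ Set.Ioo (0 : ℝ) 1)
    {g : ℕ → Env → ℝ} {D : ℝ}
    (hdep : ∀ n, ∀ ω ω' : Env, (∀ k < n, ω k = ω' k) → g n ω = g n ω')
    (hadd : ∀ m n ω, |g (m + n) ω - g m ω - g n (shift^[m] ω)| ≤ D) :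
    ∃ χ : ℝ, ∀ᵐ ω ∂(envMeasure p),
      Tendsto (fun n : ℕ => (n : ℝ)⁻¹ * g n ω) atTop (𝓝 χ) := by
  have hcoin := isProbabilityMeasure_coin hp
  have hprob : IsProbabilityMeasure (envMeasure p) := by unfold envMeasure; infer_instance
  have hD : 0 ≤ D := (abs_nonneg _).trans (hadd 0 0 fun _ => 0)
  let E : ℕ → ℝ := fun m => ∫ ω, g m ω ∂(envMeasure p)
  let a : ℕ → ℝ := fun m => E (m + 1) / ((m + 1 : ℕ) : ℝ)
  let δ : ℕ → ℝ := fun m => (D + 1) / ((m + 1 : ℕ) : ℝ)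
  have hδ : Tendsto δ atTop (𝓝 0) :=
    (tendsto_const_div_atTop_nhds_zero_nat (D + 1)).comp (tendsto_add_atTop_nat 1)
  have hae : ∀ᵐ ω ∂(envMeasure p), ∀ m : ℕ,
      ∀ᶠ n : ℕ in atTop, |(n : ℝ)⁻¹ * g n ω - a m| ≤ δ m := by
    rw [ae_all_iff]
    intro m'
    have hm : 0 < m' + 1 := Nat.succ_pos m'
    simp only [a, δ]
    generalize m' + 1 = m at hm ⊢
    have hm' : (0 : ℝ) < m := by exact_mod_cast hm
    choose B hB using fun r => exists_bound_of_dependsOn_initial (hdep r)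
    have hB0 : ∀ r, 0 ≤ B r := fun r => (abs_nonneg _).trans (hB r fun _ => 0)
    set B' := ∑ r ∈ Finset.range m, B r with hB'
    have hB'0 : 0 ≤ B' := Finset.sum_nonneg fun r _ => hB0 r
    filter_upwards [ae_tendsto_block_average hp (hdep m)] with ω hω
    have hk : Tendsto (fun n : ℕ => n / m) atTop atTop := Nat.tendsto_div_const_atTop hm.ne'
    have hclose := hk.eventually (Metric.tendsto_nhds.1 hω (1 / 2) (by norm_num))
    have hlarge := tendsto_natCast_atTop_atTop.eventually_ge_atTop
      (2 * m * (2 * D + B' + |E m|))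
    filter_upwards [hclose, hlarge, eventually_ge_atTop m] with n hn hn' hnm
    set k := n / m with hkdef
    have hk1 : 1 ≤ k := (Nat.one_le_div_iff hm).2 hnm
    have hk0 : (0 : ℝ) < k := by exact_mod_cast hk1
    have hn0 : (0 : ℝ) < n := by exact_mod_cast hm.trans_le hnm
    set r := n % m with hr
    have hrm : r < m := Nat.mod_lt n hm
    have hnk : k * m + r = n := Nat.div_add_mod' n m
    set S := ∑ j ∈ Finset.range k, g m (shift^[j * m] ω) with hS
    have h1 : |S - k * E m| ≤ k / 2 := by
      rw [Real.dist_eq] at hn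
      have h : S / k - E m = (S - k * E m) / k := by field_simp
      change |S / k - E m| < 1 / 2 at hn
      rw [h, abs_div, abs_of_pos hk0, div_lt_iff₀ hk0] at hn
      linarith
    have h2 := abs_sub_sum_blocks_le hadd m k ω
    have h3 : |g n ω - g (k * m) ω| ≤ D + B' := by
      have h4 := hadd (k * m) r ω
      rw [hnk] at h4
      have h5 := (hB r (shift^[k * m] ω)).trans
        (Finset.single_le_sum (fun r _ => hB0 r) (Finset.mem_range.2 hrm))
      rw [abs_le] at h4 h5 ⊢
      constructor <;> linarith [h4.1, h4.2, h5.1, h5.2]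
    have hncast : (k : ℝ) * m + r = n := by exact_mod_cast hnk
    have h4 : |k * E m - n * (E m / m)| ≤ |E m| := by
      have : k * E m - n * (E m / m) = -(r / m * E m) := by
        rw [← hncast]
        field_simp
        ring
      rw [this, abs_neg, abs_mul, abs_of_nonneg (by positivity)]
      refine mul_le_of_le_one_left (abs_nonneg _) ((div_le_one hm').2 ?_)
      exact_mod_cast hrm.le
    have h5 : |g n ω - n * (E m / m)| ≤ k * (D + 1 / 2) + (2 * D + B' + |E m|) := by
      rw [abs_le] at h1 h2 h3 h4 ⊢
      constructor <;> linarith [h1.1, h1.2, h2.1, h2.2, h3.1, h3.2, h4.1, h4.2]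
    have h6 : (n : ℝ)⁻¹ * g n ω - E m / m = (g n ω - n * (E m / m)) / n := by
      field_simp
    rw [h6, abs_div, abs_of_pos hn0, div_le_div_iff₀ hn0 hm']
    have hkm : (k : ℝ) * m ≤ n := by
      rw [← hncast]
      exact le_add_of_nonneg_right (by positivity)
    calc |g n ω - n * (E m / m)| * m
        ≤ (k * (D + 1 / 2) + (2 * D + B' + |E m|)) * m := by gcongr
      _ = (k * m) * (D + 1 / 2) + 2 * m * (2 * D + B' + |E m|) / 2 := by ring
      _ ≤ n * (D + 1 / 2) + n / 2 := by gcongr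
      _ = (D + 1) * n := by ring
  -- The constants `a m` converge, as is seen from any single good environment.
  obtain ⟨ω₀, hω₀⟩ := hae.exists
  have hcauchy : CauchySeq a := by
    rw [Metric.cauchySeq_iff']
    intro ε hε
    obtain ⟨M, hM⟩ := eventually_atTop.1 (hδ.eventually_lt_const (half_pos hε))
    refine ⟨M, fun m hm => ?_⟩
    obtain ⟨n, hn1, hn2⟩ := ((hω₀ m).and (hω₀ M)).exists
    rw [Real.dist_eq]
    rw [abs_le] at hn1 hn2
    rw [abs_lt]
    constructor <;> linarith [hn1.1, hn1.2, hn2.1, hn2.2, hM m hm, hM M le_rfl]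
  obtain ⟨χ, hχ⟩ := cauchySeq_tendsto_of_complete hcauchy
  refine ⟨χ, ?_⟩
  filter_upwards [hae] with ω hω
  rw [Metric.tendsto_nhds]
  intro ε hε
  obtain ⟨m, hm1, hm2⟩ := ((hδ.eventually_lt_const (half_pos hε)).and
    (Metric.tendsto_nhds.1 hχ (ε / 2) (half_pos hε))).exists
  filter_upwards [hω m] with n hn
  rw [Real.dist_eq] at hm2 ⊢
  rw [abs_le] at hn
  rw [abs_lt] at hm2 ⊢
  constructor <;> linarith [hn.1, hn.2, hm2.1, hm2.2]

/-! ### The top Lyapunov exponent -/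

theorem IsPositiveModel.entrySum_pos {A : Fin 2 → IntMat}
    {Q : Fin 2 → Matrix (Fin 2) (Fin 2) ℝ} {e : (Fin 2 → ℝ) ≃ₗ[ℝ] Plane}
    (h : IsPositiveModel A Q e) (ω : Env) (n : ℕ) : 0 < entrySum (wordProduct Q ω n) := by
  have h1 := l1_le_entrySum_mul (h.wordProduct_nonneg ω n) (det_wordProduct h.det ω n) ![1, 0]
  refine (entrySum_nonneg (h.wordProduct_nonneg ω n)).lt_of_ne fun h0 => ?_
  rw [← h0, zero_mul] at h1
  simp [l1] at h1
  linarith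

theorem wordProduct_congr (Q : Fin 2 → Matrix (Fin 2) (Fin 2) ℝ) {ω ω' : Env} {n : ℕ}
    (h : ∀ k < n, ω k = ω' k) : wordProduct Q ω n = wordProduct Q ω' n := by
  induction n with
  | zero => rfl
  | succ n ih =>
    rw [wordProduct, wordProduct, h n n.lt_succ_self, ih fun k hk => h k (hk.trans n.lt_succ_self)]

/-- Logarithms of norms of products of positive matrices are additive up to a bounded error, so
they grow linearly, at a deterministic rate. -/
theorem IsPositiveModel.exists_ae_tendsto_log_entrySum {A : Fin 2 → IntMat}
    {Q : Fin 2 → Matrix (Fin 2) (Fin 2) ℝ} {e : (Fin 2 → ℝ) ≃ₗ[ℝ] Plane}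
    (h : IsPositiveModel A Q e) {p : ℝ} (hp : p ∈ Set.Ioo (0 : ℝ) 1) :
    ∃ χ : ℝ, ∀ᵐ ω ∂(envMeasure p), Tendsto
      (fun n : ℕ => (n : ℝ)⁻¹ * Real.log (entrySum (wordProduct Q ω n))) atTop (𝓝 χ) := by
  obtain ⟨κ, hκ, hκr⟩ := exists_entry_ratio_bound h.pos
  have hbal := balanced_wordProduct h.pos hκ hκr
  refine exists_ae_tendsto_of_almost_additive hp (D := Real.log (1 + κ))
    (g := fun n ω => Real.log (entrySum (wordProduct Q ω n)))
    (fun n ω ω' hω => by simp only [wordProduct_congr Q hω]) fun m n ω => ?_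
  have hm := h.entrySum_pos ω m
  have hn := h.entrySum_pos (shift^[m] ω) n
  have hmn := h.entrySum_pos ω (m + n)
  have h1 := entrySum_mul_le (hbal (shift^[m] ω) n).nonneg (hbal ω m).nonneg
  have h2 := (hbal (shift^[m] ω) n).entrySum_mul_entrySum_le (hbal ω m).nonneg
  rw [← wordProduct_add] at h1 h2
  have h1' := Real.log_le_log hmn h1
  have h2' := Real.log_le_log (mul_pos hn hm) h2
  rw [Real.log_mul hn.ne' hm.ne'] at h1' h2'
  rw [Real.log_mul (by linarith) hmn.ne'] at h2'
  have h3 : 0 ≤ Real.log (1 + κ) := Real.log_nonneg (by linarith)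
  rw [abs_le]
  constructor <;> linarith

theorem tendsto_inv_mul_of_bounded_sub {x y : ℕ → ℝ} {χ L : ℝ}
    (hx : Tendsto (fun n : ℕ => (n : ℝ)⁻¹ * x n) atTop (𝓝 χ)) (hL : ∀ n, |y n - x n| ≤ L) :
    Tendsto (fun n : ℕ => (n : ℝ)⁻¹ * y n) atTop (𝓝 χ) := by
  have h : Tendsto (fun n : ℕ => (n : ℝ)⁻¹ * (y n - x n)) atTop (𝓝 0) :=
    tendsto_natCast_atTop_atTop.inv_tendsto_atTop.zero_mul_isBoundedUnder_le
      (isBoundedUnder_of ⟨L, fun n => by simpa using hL n⟩)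
  have := hx.add h
  rw [add_zero] at this
  exact this.congr fun n => by ring

/-- The growth rate of the norms of the products is the largest Lyapunov exponent; it is attained
at every vector of the open cone. -/
theorem IsPositiveModel.isGreatest_lyapunovExponents {A : Fin 2 → IntMat}
    {Q : Fin 2 → Matrix (Fin 2) (Fin 2) ℝ} {e : (Fin 2 → ℝ) ≃ₗ[ℝ] Plane}
    (h : IsPositiveModel A Q e) {ω : Env} {χ : ℝ}
    (hχ : Tendsto (fun n : ℕ => (n : ℝ)⁻¹ * Real.log (entrySum (wordProduct Q ω n))) atTop
      (𝓝 χ)) : IsGreatest (lyapunovExponents A ω) χ := by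
  obtain ⟨K, hK, hKe⟩ := exists_l1_bounds e
  have hN := h.entrySum_pos ω
  constructor
  · refine ⟨e ![1, 1], fun h0 => ?_, tendsto_inv_mul_of_bounded_sub hχ (L := Real.log K)
      fun n => ?_⟩
    · have := congrFun ((map_eq_zero_iff e e.injective).1 h0) 0
      simp at this
    · rw [h.norm_planeMap]
      have hl : l1 ((wordProduct Q ω n).mulVec ![1, 1]) = entrySum (wordProduct Q ω n) := by
        have hnn := h.wordProduct_nonneg ω n
        have h0 := add_nonneg (hnn 0 0) (hnn 0 1)
        have h1 := add_nonneg (hnn 1 0) (hnn 1 1)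
        simp only [l1, mulVec_zero_eq, mulVec_one_eq, Matrix.cons_val_zero, Matrix.cons_val_one,
          mul_one, abs_of_nonneg h0, abs_of_nonneg h1, entrySum]
        ring
      obtain ⟨h1, h2⟩ := hKe ((wordProduct Q ω n).mulVec ![1, 1])
      rw [hl] at h1 h2
      have hpos : 0 < ‖e ((wordProduct Q ω n).mulVec ![1, 1])‖ :=
        pos_of_mul_pos_right ((hN n).trans_le h2) hK.le
      have h1' := Real.log_le_log hpos h1
      have h2' := Real.log_le_log (hN n) h2
      rw [Real.log_mul hK.ne' (hN n).ne'] at h1'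
      rw [Real.log_mul hK.ne' hpos.ne'] at h2'
      rw [abs_le]
      constructor <;> linarith
  · rintro χ' ⟨x, hx, hχ'⟩
    set x' := e.symm x with hx'
    have hex : e x' = x := e.apply_symm_apply x
    have hl : 0 < l1 x' := by
      refine pos_of_mul_pos_right ?_ hK.le
      exact (norm_pos_iff.2 (hex.symm ▸ hx)).trans_le (hKe x').1
    have hbound : Tendsto (fun n : ℕ => (n : ℝ)⁻¹ *
        (Real.log (entrySum (wordProduct Q ω n)) + Real.log (K * l1 x'))) atTop (𝓝 χ) :=
      tendsto_inv_mul_of_bounded_sub hχ (L := |Real.log (K * l1 x')|) fun n => by simp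
    refine le_of_tendsto_of_tendsto' hχ' hbound fun n => ?_
    refine mul_le_mul_of_nonneg_left ?_ (by positivity)
    have hW := l1_le_entrySum_mul (h.wordProduct_nonneg ω n) (det_wordProduct h.det ω n) x'
    have hWpos : 0 < l1 ((wordProduct Q ω n).mulVec x') :=
      pos_of_mul_pos_right (hl.trans_le hW) (hN n).le
    obtain ⟨h1, h2⟩ := hKe ((wordProduct Q ω n).mulVec x')
    rw [← Real.log_mul (hN n).ne' (mul_pos hK hl).ne', ← hex, h.norm_planeMap]
    refine Real.log_le_log (pos_of_mul_pos_right (hWpos.trans_le h2) hK.le) (h1.trans ?_)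
    calc K * l1 ((wordProduct Q ω n).mulVec x')
        ≤ K * (entrySum (wordProduct Q ω n) * l1 x') := by
          gcongr
          exact l1_mulVec_le (h.wordProduct_nonneg ω n) x'
      _ = _ := by ring

theorem exists_pos_le_of_eventually_one_le {t : ℕ → ℝ} (ht : ∀ n, 0 < t n)
    (hev : ∀ᶠ n in atTop, 1 ≤ t n) : ∃ δ : ℝ, 0 < δ ∧ ∀ n, δ ≤ t n := by
  obtain ⟨n₀, hn₀⟩ := eventually_atTop.1 hev
  have hfin : ∀ k, ∃ δ : ℝ, 0 < δ ∧ ∀ n < k, δ ≤ t n := by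
    intro k
    induction k with
    | zero => exact ⟨1, one_pos, fun n hn => absurd hn n.not_lt_zero⟩
    | succ k ih =>
      obtain ⟨δ, hδ, hle⟩ := ih
      refine ⟨min δ (t k), lt_min hδ (ht k), fun n hn => ?_⟩
      rcases Nat.lt_succ_iff_lt_or_eq.1 hn with h | rfl
      · exact (min_le_left _ _).trans (hle n h)
      · exact min_le_right _ _
  obtain ⟨δ, hδ, hle⟩ := hfin n₀
  refine ⟨min δ 1, lt_min hδ one_pos, fun n => ?_⟩
  rcases lt_or_ge n n₀ with h | h
  · exact (min_le_left _ _).trans (hle n h)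
  · exact (min_le_right _ _).trans (hn₀ n h)

/-- A process growing exponentially at rate `χ` is bounded below by `K e^{(χ - ε) n}` with a
measurable random constant `K > 0`, namely the infimum of the quotients where it is positive, and an
arbitrary value on the exceptional null set. -/
theorem exists_measurable_lower_bound {μ : Measure Env} {N : Env → ℕ → ℝ}
    (hmeas : ∀ n, Measurable fun ω => N ω n) (hpos : ∀ ω n, 0 < N ω n) {χ : ℝ}
    (hχ : ∀ᵐ ω ∂μ, Tendsto (fun n : ℕ => (n : ℝ)⁻¹ * Real.log (N ω n)) atTop (𝓝 χ)) {ε : ℝ}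
    (hε : 0 < ε) :
    ∃ K : Env → ℝ, Measurable K ∧ (∀ ω, 0 < K ω) ∧
      ∀ᵐ ω ∂μ, ∀ n : ℕ, K ω * Real.exp ((χ - ε) * n) ≤ N ω n := by
  let t : Env → ℕ → ℝ := fun ω n => N ω n * Real.exp (-((χ - ε) * n))
  have ht : ∀ ω n, 0 < t ω n := fun ω n => mul_pos (hpos ω n) (Real.exp_pos _)
  have hinf : Measurable fun ω => ⨅ n, t ω n :=
    Measurable.iInf fun n => (hmeas n).mul_const _
  refine ⟨fun ω => if 0 < ⨅ n, t ω n then ⨅ n, t ω n else 1,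
    Measurable.ite (measurableSet_lt measurable_const hinf) hinf measurable_const,
    fun ω => by dsimp only; split_ifs with h; exacts [h, one_pos], ?_⟩
  filter_upwards [hχ] with ω hω n
  have hev : ∀ᶠ n in atTop, 1 ≤ t ω n := by
    filter_upwards [hω.eventually_const_lt (sub_lt_self χ hε), eventually_gt_atTop 0] with n hn hn0
    have hn0' : (0 : ℝ) < n := by exact_mod_cast hn0
    rw [inv_mul_eq_div, lt_div_iff₀ hn0'] at hn
    have : Real.exp ((χ - ε) * n) ≤ N ω n := by
      rw [← Real.exp_log (hpos ω n)]
      exact Real.exp_le_exp.2 hn.le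
    simp only [t, Real.exp_neg]
    rwa [← div_eq_mul_inv, one_le_div (Real.exp_pos _)]
  obtain ⟨δ, hδ, hle⟩ := exists_pos_le_of_eventually_one_le (ht ω) hev
  have hi : 0 < ⨅ n, t ω n := hδ.trans_le (le_ciInf hle)
  have hle' : ⨅ n, t ω n ≤ t ω n := ciInf_le ⟨δ, by rintro _ ⟨n, rfl⟩; exact hle n⟩ n
  rw [if_pos hi]
  calc (⨅ n, t ω n) * Real.exp ((χ - ε) * n) ≤ t ω n * Real.exp ((χ - ε) * n) := by gcongr
    _ = N ω n := by
      simp only [t]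
      rw [mul_assoc, ← Real.exp_add, neg_add_cancel, Real.exp_zero, mul_one]

theorem rpow_neg_le_of_inv_le {t c β : ℝ} (ht : 0 < t) (hc : 1 ≤ c) (htc : t⁻¹ ≤ c)
    (hβ : β ∈ Set.Ioc (0 : ℝ) 1) : t ^ (-β) ≤ c := by
  rw [Real.rpow_neg ht.le, ← Real.inv_rpow ht.le]
  calc t⁻¹ ^ β ≤ c ^ β := Real.rpow_le_rpow (inv_pos.2 ht).le htc hβ.1.le
    _ ≤ c ^ (1 : ℝ) := Real.rpow_le_rpow_of_exponent_le hc hβ.2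
    _ = c := Real.rpow_one c

end RandomToral

end

/-! ### Decay of correlations for random toral automorphisms -/

theorem theorem2
    (A : Fin 2 → RandomToral.IntMat) (E C : Set RandomToral.Plane) (lamE lamC : ℝ)
    (hA : RandomToral.HasConeProperty A E C lamE lamC)
    (p : ℝ) (hp : p ∈ Set.Ioo (0 : ℝ) 1) :
    0 < Real.log (min lamC⁻¹ lamE) ∧
    ∃ c : ℝ, 0 < c ∧
      (∀ β ∈ Set.Ioc (0 : ℝ) 1, ∀ f g : RandomToral.Env × RandomToral.Torus → ℂ,
        RandomToral.StrongHolder β f → RandomToral.StrongHolder β g →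
        ∀ (ω : RandomToral.Env) (n : ℕ),
          ‖RandomToral.corr A f g ω n‖ ≤
            c * RandomToral.holderNorm β f * RandomToral.holderNorm β g *
              Real.exp (-(Real.log (min lamC⁻¹ lamE) * β * n)) ∧
          ‖RandomToral.corrSkew A f g ω n‖ ≤
            c * RandomToral.holderNorm β f * RandomToral.holderNorm β g *
              Real.exp (-(Real.log (min lamC⁻¹ lamE) * β * n))) ∧
      ∃ χ : ℝ, RandomToral.IsTopLyapunovExponent A p χ ∧
        Real.log (max lamC⁻¹ lamE) ≤ χ ∧
        ∀ ε : ℝ, 0 < ε → ∃ K : RandomToral.Env → ℝ, Measurable K ∧ (∀ ω, 0 < K ω) ∧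
          ∀ᵐ ω ∂(RandomToral.envMeasure p),
            ∀ β ∈ Set.Ioc (0 : ℝ) 1, ∀ f g : RandomToral.Env × RandomToral.Torus → ℂ,
              RandomToral.StrongHolder β f → RandomToral.StrongHolder β g →
              ∀ n : ℕ,
                ‖RandomToral.corr A f g ω n‖ ≤
                  c * RandomToral.holderNorm β f * RandomToral.holderNorm β g *
                    K ω ^ (-β) * Real.exp (-((χ - ε) * β * n)) ∧
                ‖RandomToral.corrSkew A f g ω n‖ ≤
                  c * RandomToral.holderNorm β f * RandomToral.holderNorm β g *
                    K ω ^ (-β) * Real.exp (-((χ - ε) * β * n)) := by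
  have hdet : ∀ i, (A i).det = 1 := fun i => (hA.hyperbolic i).1
  have hCinv : 1 < lamC⁻¹ := (one_lt_inv₀ hA.contraction.pos).2 hA.contraction.lt_one
  have hmin : 1 < min lamC⁻¹ lamE := lt_min hCinv hA.expansion.one_lt
  refine ⟨Real.log_pos hmin, ?_⟩
  obtain ⟨Q, e, hQ⟩ := hA.expansion.exists_isPositiveModel hdet
  obtain ⟨c₀, hc₀, hsep⟩ := hQ.exists_entrySum_le_intNorm hdet
  obtain ⟨c₁, hc₁, hgrow⟩ := hA.exists_pow_le_entrySum hQ
  have hNpos := hQ.entrySum_pos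
  have hc₀' : 0 < c₀⁻¹ := inv_pos.2 hc₀
  have hc₁' : 0 < (c₀ * c₁)⁻¹ := inv_pos.2 (mul_pos hc₀ hc₁)
  have hnn : ∀ β f, 0 ≤ RandomToral.holderNorm β f := fun _ _ => ENNReal.toReal_nonneg
  -- The constant has to dominate both `c₀ ^ (-β)` and `(c₀ * c₁) ^ (-β)` for all `β ∈ (0, 1]`.
  refine ⟨1 + c₀⁻¹ + (c₀ * c₁)⁻¹, by positivity, fun β hβ f g hf hg ω n => ?_, ?_⟩
  · set m := min lamC⁻¹ lamE with hm
    have hm0 : 0 < m := one_pos.trans hmin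
    have hR : 0 < (c₀ * c₁) * m ^ n := by positivity
    have hRle : (c₀ * c₁) * m ^ n ≤ c₀ * RandomToral.entrySum (RandomToral.wordProduct Q ω n) := by
      rw [mul_assoc]
      gcongr
      refine le_trans ?_ (hgrow ω n)
      gcongr
      exact min_le_max
    have hbound : RandomToral.holderNorm β f * RandomToral.holderNorm β g *
        ((c₀ * c₁) * m ^ n) ^ (-β) ≤ (1 + c₀⁻¹ + (c₀ * c₁)⁻¹) * RandomToral.holderNorm β f *
          RandomToral.holderNorm β g * Real.exp (-(Real.log m * β * n)) := by
      have hexp : (m ^ n) ^ (-β) = Real.exp (-(Real.log m * β * n)) := by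
        rw [Real.rpow_def_of_pos (pow_pos hm0 n), Real.log_pow]
        congr 1
        ring
      rw [Real.mul_rpow (by positivity) (by positivity), hexp]
      have := RandomToral.rpow_neg_le_of_inv_le (mul_pos hc₀ hc₁)
        (c := 1 + c₀⁻¹ + (c₀ * c₁)⁻¹) (by linarith) (by linarith) hβ
      have h1 := hnn β f
      have h2 := hnn β g
      calc _ = (c₀ * c₁) ^ (-β) * RandomToral.holderNorm β f * RandomToral.holderNorm β g *
            Real.exp (-(Real.log m * β * n)) := by ring
        _ ≤ _ := by gcongr
    obtain ⟨h1, h2⟩ := RandomToral.norm_corr_le hdet hβ.1 hf hg ω n hR fun q hq =>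
      hRle.trans (hsep ω n q hq)
    exact ⟨h1.trans hbound, h2.trans hbound⟩
  · obtain ⟨χ, hχ⟩ := hQ.exists_ae_tendsto_log_entrySum hp
    have hcoin := RandomToral.isProbabilityMeasure_coin hp
    have hprob : IsProbabilityMeasure (RandomToral.envMeasure p) := by
      unfold RandomToral.envMeasure; infer_instance
    refine ⟨χ, ?_, ?_, fun ε hε => ?_⟩
    · filter_upwards [hχ] with ω hω
      exact hQ.isGreatest_lyapunovExponents hω
    · obtain ⟨ω, hω⟩ := hχ.exists
      set M := max lamC⁻¹ lamE
      have hM0 : 0 < M := (one_pos.trans hCinv).trans_le (le_max_left _ _)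
      have hlow : Tendsto (fun n : ℕ => (n : ℝ)⁻¹ * (Real.log c₁ + n * Real.log M)) atTop
          (𝓝 (Real.log M)) := by
        refine RandomToral.tendsto_inv_mul_of_bounded_sub (x := fun n : ℕ => n * Real.log M)
          (L := |Real.log c₁|) ?_ fun n => by simp
        refine tendsto_const_nhds.congr' ?_
        filter_upwards [eventually_gt_atTop 0] with n hn
        have : (n : ℝ) ≠ 0 := by exact_mod_cast hn.ne'
        field_simp
      refine le_of_tendsto_of_tendsto' hlow hω fun n => ?_
      refine mul_le_mul_of_nonneg_left ?_ (by positivity)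
      rw [← Real.log_pow, ← Real.log_mul hc₁.ne' (pow_pos hM0 n).ne']
      exact Real.log_le_log (by positivity) (hgrow ω n)
    · obtain ⟨K, hKm, hK0, hK⟩ := RandomToral.exists_measurable_lower_bound
        (fun n => RandomToral.measurable_of_dependsOn_initial (m := n) fun ω ω' hω => by
          rw [RandomToral.wordProduct_congr Q hω]) hNpos hχ hε
      refine ⟨K, hKm, hK0, ?_⟩
      filter_upwards [hK] with ω hω β hβ f g hf hg n
      have hexp0 := Real.exp_pos ((χ - ε) * n)
      have hR : 0 < c₀ * (K ω * Real.exp ((χ - ε) * n)) := by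
        have := hK0 ω
        positivity
      have hbound : RandomToral.holderNorm β f * RandomToral.holderNorm β g *
          (c₀ * (K ω * Real.exp ((χ - ε) * n))) ^ (-β) ≤
          (1 + c₀⁻¹ + (c₀ * c₁)⁻¹) * RandomToral.holderNorm β f * RandomToral.holderNorm β g *
            K ω ^ (-β) * Real.exp (-((χ - ε) * β * n)) := by
        have hexp : Real.exp ((χ - ε) * n) ^ (-β) = Real.exp (-((χ - ε) * β * n)) := by
          rw [← Real.exp_mul]
          congr 1
          ring
        rw [Real.mul_rpow hc₀.le (by have := hK0 ω; positivity),
          Real.mul_rpow (hK0 ω).le hexp0.le, hexp]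
        have := RandomToral.rpow_neg_le_of_inv_le hc₀
          (c := 1 + c₀⁻¹ + (c₀ * c₁)⁻¹) (by linarith) (by linarith) hβ
        have h1 := hnn β f
        have h2 := hnn β g
        have h3 : 0 ≤ K ω ^ (-β) := Real.rpow_nonneg (hK0 ω).le _
        calc _ = c₀ ^ (-β) * RandomToral.holderNorm β f * RandomToral.holderNorm β g *
              K ω ^ (-β) * Real.exp (-((χ - ε) * β * n)) := by ring
          _ ≤ _ := by gcongr
      obtain ⟨h1, h2⟩ := RandomToral.norm_corr_le hdet hβ.1 hf hg ω n hR fun q hq =>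
        (mul_le_mul_of_nonneg_left (hω n) hc₀.le).trans (hsep ω n q hq)
      exact ⟨h1.trans hbound, h2.trans hbound⟩
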